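/- Let $d\ge 1$, let $S_t=S_0+\xi_1+\dots+\xi_t$ ($t\ge 0$) be a random walk on $\mathbb Z^d$, write $x[1]$ for the first coordinate of $x\in\mathbb Z^d$ and $\mathbb Z^d_{0+}=\{x: x[1]\ge 0\}$, and let $\{H(x)\}_{x\in\mathbb Z^d}$ be random variables with values in $\{0,1,2,\dots\}\cup\{\infty\}$. Put $L_t(x)=\#\{0\le j\le t: S_j=x\}$, $T_*=\inf\{t\ge0: L_t(S_t)>H(S_t)\}$, $\alpha(n)=\inf\{t\ge 0: S_t[1]\ge n\}$ and $B_n=\{\alpha(n)<T_*\}$ (with $\inf\emptyset=\infty$). A number $k\in\{0,\dots,n\}$ is an $n$-separating level if $\alpha(n)<\infty$ and $$\sup_{0\le t<\alpha(k)}S_t[1]<k=S_{\alpha(k)}[1]\le\inf_{\alpha(k)<t<\alpha(n)}S_t[1].$$ On $B_n$ let $\eta_*(n)+1$ be the number of $n$-separating levels, and off $B_n$ let $\eta_*(n)=-1$. If $\eta_*(n)\ge1$, let $\varkappa_*(n)$ be the largest $n$-separating level $k<n$; otherwise let $\varkappa_*(n)=-\infty$. Write $\mathbf P_*$ for the probability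 in this model and $\mathbf P_0$ for the probability when $S_0=0$ and $H(y)=0$ for all $y\notin\mathbb Z^d_{0+}$ (the $\xi_i$ and the $H(x)$, $x\in\mathbb Z^d_{0+}$, being unchanged). Assume: (A1) $\xi_1,\xi_2,\dots$ are i.i.d. in $\mathbb Z^d$, $\xi_1[1]\le 1$ a.s. and $\mathbf P(\xi_1[1]=1)>0$. (A2) The families $\{S_0;\,H(x),x\notin\mathbb Z^d_{0+}\}$, $\{\xi_i,i\ge1\}$ and $\{H(x),x\in\mathbb Z^d_{0+}\}$ are mutually independent, $S_0[1]\le 0$ a.s., and $\mathbf P_*(B_0)>0$. (A3) The variables $H(x)$, $x\in\mathbb Z^d_{0+}$, are i.i.d. and $\mathbf P(1\le H(0)\le\infty)=1$. (A4) With $\beta_0=\inf\{t>0:\xi_1[1]+\dots+\xi_t[1]=0\}$ and $\beta_{0,0}=\inf\{t>0:\xi_1+\dots+\xi_t=0\}$: if $\mathbf P(\beta_0<\infty)=1$, then $\mathbf P(\beta_{0,0}<\infty)>0$; and if $\mathbf P(\beta_0=\beta_{0,0}<\infty)=1$, then $\mathbf E H(0)<\infty$. (A5) If $\mathbf P(\beta_0<\infty)=1$,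 then $\mathbf P(H(0)<\infty)>0$. Then there is a number $q\in(0,1]$ such that $$\sum_{k=1}^\infty \frac{\mathbf P_0(\varkappa_*(k)=0)}{q^k}=1,\qquad 1\le\mu:=\sum_{k=1}^\infty \frac{k\,\mathbf P_0(\varkappa_*(k)=0)}{q^k}<\infty,\qquad 0<\psi_0:=\sum_{m=0}^\infty\frac{\mathbf P_*(\eta_*(m)=0)}{q^m}<\infty.$$ -/

import Mathlib

open MeasureTheory ProbabilityTheory
open scoped ENNReal

noncomputable section

namespace LocalConstraints

/-- The first time `t ≥ 0` at which `p t` holds, with `inf ∅ = ∞`. -/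
def firstTime (p : ℕ → Prop) : ℕ∞ := ⨅ (t : ℕ) (_ : p t), (t : ℕ∞)

/-- The lattice `ℤ^d`; the first coordinate ("height") of `x` is `x 0`. -/
abbrev Lattice (d : ℕ) : Type := Fin d → ℤ

section Paths

variable {d : ℕ} [NeZero d]

/-- `α(n | y) = inf {t ≥ 0 : y_t[1] ≥ n}`. -/
def hit (n : ℕ) (y : ℕ → Lattice d) : ℕ∞ := firstTime fun t => (n : ℤ) ≤ y t 0

/-- The local time `L_t(x) = #{0 ≤ j ≤ t : y_j = x}`. -/
def localTime (y : ℕ → Lattice d) (t : ℕ) (x : Lattice d) : ℕ :=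
  ((Finset.range (t + 1)).filter fun j => y j = x).card

/-- The killing time `T_* = inf {t ≥ 0 : L_t(y_t) > h(y_t)}` in the environment `h`. -/
def killTime (y : ℕ → Lattice d) (h : Lattice d → ℕ∞) : ℕ∞ :=
  firstTime fun t => h (y t) < (localTime y t (y t) : ℕ∞)

/-- The event `B_n = {α(n) < T_*}`. -/
def Reaches (n : ℕ) (y : ℕ → Lattice d) (h : Lattice d → ℕ∞) : Prop :=
  hit n y < killTime y h

/-- `k ∈ {0, …, n}` is an `n`-separating level of the path `y`: `α(n) < ∞` and
`sup_{t < α(k)} y_t[1] < k = y_{α(k)}[1] ≤ inf_{α(k) < t < α(n)} y_t[1]`. -/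
def IsSeparating (n : ℕ) (y : ℕ → Lattice d) (k : ℕ) : Prop :=
  k ≤ n ∧ hit n y < ⊤ ∧
    (∀ t : ℕ, (t : ℕ∞) < hit k y → y t 0 < (k : ℤ)) ∧
    y (hit k y).toNat 0 = (k : ℤ) ∧
    ∀ t : ℕ, hit k y < (t : ℕ∞) → (t : ℕ∞) < hit n y → (k : ℤ) ≤ y t 0

open Classical in
/-- `η(n | y)`: the number of `n`-separating levels, minus one. -/
def eta (n : ℕ) (y : ℕ → Lattice d) : ℤ :=
  (((Finset.range (n + 1)).filter (IsSeparating n y)).card : ℤ) - 1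

open Classical in
/-- `ϰ(n | y)`: the largest `n`-separating level `k < n`, and `-∞` (that is `⊥`) if there is none. -/
def kappa (n : ℕ) (y : ℕ → Lattice d) : WithBot ℕ :=
  ((Finset.range n).filter (IsSeparating n y)).max

open Classical in
/-- `η_*(n)`, equal to `η(n | y)` if `α(n) < T_*` and to `-1` otherwise. -/
def etaStar (n : ℕ) (y : ℕ → Lattice d) (h : Lattice d → ℕ∞) : ℤ :=
  if Reaches n y h then eta n y else -1

open Classical in
/-- `ϰ_*(n)`, equal to `ϰ(n | y)` if `η_*(n) ≥ 1` and to `-∞` otherwise. -/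
def kappaStar (n : ℕ) (y : ℕ → Lattice d) (h : Lattice d → ℕ∞) : WithBot ℕ :=
  if 1 ≤ etaStar n y h then kappa n y else ⊥

/-- The environment which agrees with `h` on the half-space `x[1] ≥ 0` and vanishes off it. -/
def zeroBelow (h : Lattice d → ℕ∞) (x : Lattice d) : ℕ∞ := if 0 ≤ x 0 then h x else 0

/-- The path `y_t = s + ξ_1 + ⋯ + ξ_t`; the increment `ξ_{j+1}` is written `ξ j`. -/
def walk (s : Lattice d) (ξ : ℕ → Lattice d) (t : ℕ) : Lattice d :=
  s + ∑ j ∈ Finset.range t, ξ j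

/-- `β_0 = inf {t > 0 : ξ_1[1] + ⋯ + ξ_t[1] = 0}`. -/
def returnLevel (ξ : ℕ → Lattice d) : ℕ∞ := firstTime fun t => 0 < t ∧ walk 0 ξ t 0 = 0

/-- `β_{0,0} = inf {t > 0 : ξ_1 + ⋯ + ξ_t = 0}`. -/
def returnOrigin (ξ : ℕ → Lattice d) : ℕ∞ := firstTime fun t => 0 < t ∧ walk 0 ξ t = 0

end Paths

section Model

variable {d : ℕ} [NeZero d] {Ω : Type*} [MeasurableSpace Ω]

/-- (A1): i.i.d. increments whose first coordinate is skip-free to the right. -/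
structure A1 (P : Measure Ω) (ξ : ℕ → Ω → Lattice d) : Prop where
  measurable : ∀ j, Measurable (ξ j)
  indep : iIndepFun ξ P
  ident : ∀ j, IdentDistrib (ξ j) (ξ 0) P P
  skipFree : ∀ᵐ ω ∂P, ξ 0 ω 0 ≤ 1
  up : 0 < P {ω | ξ 0 ω 0 = 1}

/-- (A2): the families `{S_0; H(x), x[1] < 0}`, `{ξ_i}` and `{H(x), x[1] ≥ 0}` are mutually
independent, `S_0[1] ≤ 0` a.s., and `P(B_0) > 0`. -/
structure A2 (P : Measure Ω) (S₀ : Ω → Lattice d) (ξ : ℕ → Ω → Lattice d)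
    (H : Lattice d → Ω → ℕ∞) : Prop where
  measurable_start : Measurable S₀
  measurable_env : ∀ x, Measurable (H x)
  indep : iIndep
    (![MeasurableSpace.comap S₀ inferInstance ⊔
          ⨆ x : {x : Lattice d // x 0 < 0}, MeasurableSpace.comap (H x) inferInstance,
        ⨆ j : ℕ, MeasurableSpace.comap (ξ j) inferInstance,
        ⨆ x : {x : Lattice d // 0 ≤ x 0}, MeasurableSpace.comap (H x) inferInstance] :
      Fin 3 → MeasurableSpace Ω) P
  start : ∀ᵐ ω ∂P, S₀ ω 0 ≤ 0
  reach : 0 < P {ω | Reaches 0 (walk (S₀ ω) fun j => ξ j ω) fun x => H x ω}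

/-- (A3): the constraints in the half-space `x[1] ≥ 0` are i.i.d. with values in `[1, ∞]`. -/
structure A3 (P : Measure Ω) (H : Lattice d → Ω → ℕ∞) : Prop where
  indep : iIndepFun (fun (x : {x : Lattice d // 0 ≤ x 0}) => H x) P
  ident : ∀ x : Lattice d, 0 ≤ x 0 → IdentDistrib (H x) (H 0) P P
  one_le : ∀ᵐ ω ∂P, 1 ≤ H 0 ω

/-- (A4): if `β_0 < ∞` a.s. then `P(β_{0,0} < ∞) > 0`; if `β_0 = β_{0,0} < ∞` a.s. then
`E H(0) < ∞`. -/
structure A4 (P : Measure Ω) (ξ : ℕ → Ω → Lattice d) (H : Lattice d → Ω → ℕ∞) : Prop where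
  return_origin : P {ω | returnLevel (fun j => ξ j ω) < ⊤} = 1 →
    0 < P {ω | returnOrigin (fun j => ξ j ω) < ⊤}
  finite_mean : P {ω | returnLevel (fun j => ξ j ω) = returnOrigin (fun j => ξ j ω) ∧
      returnOrigin (fun j => ξ j ω) < ⊤} = 1 →
    ∫⁻ ω, (H 0 ω : ℝ≥0∞) ∂P < ⊤
/-- `P_*(η_*(n) = 0)`. -/
def probEtaZero (P : Measure Ω) (S₀ : Ω → Lattice d) (ξ : ℕ → Ω → Lattice d)
    (H : Lattice d → Ω → ℕ∞) (n : ℕ) : ℝ :=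
  P.real {ω | etaStar n (walk (S₀ ω) fun j => ξ j ω) (fun x => H x ω) = 0}

/-- `P_0(ϰ_*(n) = 0)`, where under `P_0` the walk starts from `0` and `H(x) = 0` whenever
`x[1] < 0`. By the independence in (A2) conditioning on these values of `S_0` and of
`(H(x))_{x[1] < 0}` amounts to substituting them. -/
def probKappaZero (P : Measure Ω) (ξ : ℕ → Ω → Lattice d) (H : Lattice d → Ω → ℕ∞)
    (n : ℕ) : ℝ :=
  P.real {ω | kappaStar n (walk 0 fun j => ξ j ω) (zeroBelow fun x => H x ω) = (0 : ℕ)}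

end Model

end LocalConstraints

end

/-!
A separating level is a regeneration level: above it the walk meets fresh constraints and is a
translate of the walk under `P₀`. With `u n = P₀(level n is reached before death)` and
`f k = P₀(ϰ(k) = 0)`, cutting at the last separating level gives the renewal equation
`u n = ∑ f k * u (n - k)`.

The renewal equation implies `u a * u b ≤ u (a + b)`. Conversely, cutting a path that reaches
`a + b` at its last visit to the level `a` gives `u (a + b) ≤ N * u a * u b`, where `N` is the
expected number of visits to a level by the walk that obeys the constraints. If `N < ∞`, then
`q ^ n / N ≤ u n ≤ q ^ n` for some `q`, so `u n / q ^ n` is a renewal sequence that stays away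
from `0`, and its lifetimes have total mass `1` and a finite mean. The sum `ψ₀` converges because
`∑ P(η(m) = 0) * u (n - m)` is the probability that the original walk reaches `n` before death,
which is at most `N * u n`.

That `N < ∞` is seen on the walk induced on a level. It may return with probability less than `1`,
and then `N` is bounded by a geometric series; or it may only ever stay put, and then
`N ≤ E H(0) < ∞`. Otherwise it keeps discovering new sites, and by (A4) it can run through a loop
at many of them more than `h` times; each such site costs a factor `P(H(0) > h)`, which is less
than `1` for some `h` by (A5), so the probability of surviving many returns is summable.
-/

noncomputable section

namespace LocalConstraints

section Sums

variable {α β : Type*}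

variable {f : α → ℝ≥0∞} {g : β → ℝ≥0∞}

theorem tsum_le_tsum_of_injOn (i : α → β) (hi : Set.InjOn i (Function.support f))
    (h : ∀ a, f a ≠ 0 → f a ≤ g (i a)) : ∑' a, f a ≤ ∑' b, g b :=
  calc ∑' a, f a = ∑' a : Function.support f, f a := (tsum_subtype_support f).symm
    _ ≤ ∑' a : Function.support f, g (i a) := ENNReal.tsum_le_tsum fun a => h a a.2
    _ ≤ ∑' b, g b := ENNReal.tsum_comp_le_tsum_of_injective hi.injective g

theorem tsum_le_tsum_of_exists_preimage (π : β → α)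
    (h : ∀ a, f a ≠ 0 → ∃ b, π b = a ∧ f a ≤ g b) : ∑' a, f a ≤ ∑' b, g b := by
  choose i hπ hi using fun a : Function.support f => h a a.2
  have hinj : Function.Injective i := fun a a' haa =>
    Subtype.ext ((hπ a).symm.trans ((congrArg π haa).trans (hπ a')))
  calc ∑' a, f a = ∑' a : Function.support f, f a := (tsum_subtype_support f).symm
    _ ≤ ∑' a : Function.support f, g (i a) := ENNReal.tsum_le_tsum hi
    _ ≤ ∑' b, g b := ENNReal.tsum_comp_le_tsum_of_injective hinj g

theorem tsum_mul_tsum (f : α → ℝ≥0∞) (g : β → ℝ≥0∞) :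
    (∑' a, f a) * ∑' b, g b = ∑' x : α × β, f x.1 * g x.2 := by
  rw [ENNReal.tsum_prod (f := fun a b => f a * g b)]
  simp only [ENNReal.tsum_mul_left, ENNReal.tsum_mul_right]

end Sums

/-! ### Paths as lists of steps -/

section Sites

variable {E : Type*} [AddCommGroup E]

/-- The sites visited by the path with steps `l` started at `s`, its endpoint `s + l.sum` excluded,
so that the sites of a concatenation are the concatenated sites. -/
def sites : E → List E → List E
  | _, [] => []
  | s, a :: l => s :: sites (s + a) l

@[simp] theorem sites_nil (s : E) : sites s [] = [] := rfl

@[simp] theorem sites_cons (s a : E) (l : List E) :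
    sites s (a :: l) = s :: sites (s + a) l := rfl

theorem sites_append (s : E) (l l' : List E) :
    sites s (l ++ l') = sites s l ++ sites (s + l.sum) l' := by
  induction l generalizing s with
  | nil => simp
  | cons a l ih => simp [ih, add_assoc]

theorem sites_add (s c : E) (l : List E) : sites (s + c) l = (sites s l).map (· + c) := by
  induction l generalizing s with
  | nil => simp
  | cons a l ih => simp [← ih, add_right_comm]

theorem mem_sites_iff_sub_mem {s x : E} {l : List E} : x ∈ sites s l ↔ x - s ∈ sites 0 l := by
  rw [← zero_add s, sites_add, List.mem_map, zero_add]
  exact ⟨by rintro ⟨y, hy, rfl⟩; simpa using hy, fun h => ⟨_, h, by simp⟩⟩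

theorem add_mem_sites_iff {s x : E} {l : List E} : x + s ∈ sites s l ↔ x ∈ sites 0 l := by
  rw [mem_sites_iff_sub_mem, add_sub_cancel_right]

theorem add_sum_mem_sites_append {s : E} {l c : List E} (hc : c ≠ []) :
    s + l.sum ∈ sites s (l ++ c) := by
  cases c with
  | nil => exact absurd rfl hc
  | cons a c => simp [sites_append]

end Sites

section Weights

variable {α : Type*} {p : α → ℝ≥0∞}

/-- The product of the weights `p a` of the steps `a` of a path. -/
def pathProb (p : α → ℝ≥0∞) (l : List α) : ℝ≥0∞ := (l.map p).prod

@[simp] theorem pathProb_nil : pathProb p [] = 1 := by simp [pathProb]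

@[simp] theorem pathProb_cons (a : α) (l : List α) : pathProb p (a :: l) = p a * pathProb p l := by
  simp [pathProb]

theorem pathProb_append (l l' : List α) :
    pathProb p (l ++ l') = pathProb p l * pathProb p l' := by simp [pathProb]

theorem apply_ne_zero_of_pathProb_ne_zero {l : List α} (h : pathProb p l ≠ 0) {a : α}
    (ha : a ∈ l) : p a ≠ 0 :=
  fun h0 => h (List.prod_eq_zero (List.mem_map.2 ⟨a, ha, h0⟩))

variable [DecidableEq α] {G : ℕ → ℝ≥0∞} {M M' : List α}

/-- The probability that i.i.d. constraints, each at least `k` with probability `G k`, allow all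
the visits in the list `M`. -/
def allowProb (G : ℕ → ℝ≥0∞) (M : List α) : ℝ≥0∞ := ∏ x ∈ M.toFinset, G (M.count x)

@[simp] theorem allowProb_nil : allowProb G ([] : List α) = 1 := by simp [allowProb]

theorem allowProb_eq_prod (h0 : G 0 = 1) {T : Finset α} (hT : M.toFinset ⊆ T) :
    allowProb G M = ∏ x ∈ T, G (M.count x) := by
  refine Finset.prod_subset hT fun x _ hx => ?_
  rw [List.count_eq_zero_of_not_mem (by simpa using hx), h0]

theorem allowProb_anti (h0 : G 0 = 1) (hG : Antitone G) (h : ∀ x, M.count x ≤ M'.count x) :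
    allowProb G M' ≤ allowProb G M := by
  have hsub : M.toFinset ⊆ M'.toFinset := fun x hx => by
    rw [List.mem_toFinset, ← List.count_pos_iff] at hx ⊢
    exact hx.trans_le (h x)
  rw [allowProb_eq_prod h0 hsub]
  exact Finset.prod_le_prod' fun x _ => hG (h x)

theorem allowProb_le_one (h0 : G 0 = 1) (hG : Antitone G) (M : List α) : allowProb G M ≤ 1 := by
  simpa using allowProb_anti h0 hG (M := []) (M' := M) (by simp)

theorem allowProb_append (h : M.Disjoint M') :
    allowProb G (M ++ M') = allowProb G M * allowProb G M' := by
  rw [allowProb, List.toFinset_append,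
    Finset.prod_union (List.disjoint_toFinset_iff_disjoint.2 h)]
  congr 1
  · refine Finset.prod_congr rfl fun x hx => ?_
    rw [List.count_append, List.count_eq_zero_of_not_mem (h (by simpa using hx)), add_zero]
  · refine Finset.prod_congr rfl fun x hx => ?_
    rw [List.count_append, List.count_eq_zero_of_not_mem (h.symm (by simpa using hx)), zero_add]

theorem allowProb_cons_of_notMem (h1 : G 1 = 1) {x : α} (h : x ∉ M) :
    allowProb G (x :: M) = allowProb G M := by
  have := allowProb_append (G := G) (M := [x]) (M' := M) (by simpa using h)
  simpa [allowProb, h1] using this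

theorem allowProb_map {β : Type*} [DecidableEq β] {f : α → β} (hf : Function.Injective f) :
    allowProb G (M.map f) = allowProb G M := by
  have himage : (M.map f).toFinset = M.toFinset.image f := by ext; simp
  rw [allowProb, himage, Finset.prod_image hf.injOn]
  exact Finset.prod_congr rfl fun x _ => by rw [List.count_map_of_injective _ _ hf]

theorem allowProb_filter_sites {E : Type*} [AddCommGroup E] [DecidableEq E] (P : E → Bool) (s : E)
    (l : List E) :
    allowProb G ((sites s l).filter P) = allowProb G ((sites 0 l).filter fun x => P (x + s)) := by
  conv_lhs => rw [← zero_add s, sites_add, List.filter_map, allowProb_map (add_left_injective s)]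
  rfl

theorem allowProb_sites {E : Type*} [AddCommGroup E] [DecidableEq E] (s : E) (l : List E) :
    allowProb G (sites s l) = allowProb G (sites 0 l) := by
  simpa using allowProb_filter_sites (G := G) (fun _ => true) s l

end Weights

/-! ### First passages, separating levels and renewal -/

section FirstPassage

variable {d : ℕ} [NeZero d] {s z : Lattice d} {m n : ℤ} {l l₂ l' l₂' : List (Lattice d)}

/-- All steps raise the level by at most one. -/
def SkipFree (l : List (Lattice d)) : Prop := ∀ a ∈ l, a 0 ≤ 1

/-- The path from `s` with steps `l` ends at its first visit to the levels `≥ n`, on level `n`. -/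
def FirstPassage (s : Lattice d) (n : ℤ) (l : List (Lattice d)) : Prop :=
  (s + l.sum) 0 = n ∧ ∀ x ∈ sites s l, x 0 < n

/-- A first passage to level `n` of the path from the origin that stays at levels `≥ 0`. -/
def Upward (n : ℕ) (l : List (Lattice d)) : Prop :=
  FirstPassage 0 n l ∧ ∀ x ∈ sites 0 l, 0 ≤ x 0

/-- The path from `s` does not go below `m` after its first passage to level `m`. -/
def Separates (s : Lattice d) (l : List (Lattice d)) (m : ℤ) : Prop :=
  ∃ l₁ l₂, l = l₁ ++ l₂ ∧ FirstPassage s m l₁ ∧ ∀ x ∈ sites (s + l₁.sum) l₂, m ≤ x 0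

/-- A first passage to level `m` with no separating level in `A` below `m`. -/
def Unseparated (A : Set ℕ) (s : Lattice d) (m : ℕ) (l : List (Lattice d)) : Prop :=
  FirstPassage s m l ∧ ∀ j ∈ A, j < m → ¬ Separates s l j

/-- An upward path without separating levels strictly between its ends: the part of a path between
two consecutive separating levels. -/
def IsBlock (k : ℕ) (l : List (Lattice d)) : Prop :=
  Upward k l ∧ ∀ j : ℕ, 0 < j → j < k → ¬ Separates 0 l j

theorem SkipFree.of_pathProb_ne_zero {p : Lattice d → ℝ≥0∞}
    (hp : ∀ a : Lattice d, p a ≠ 0 → a 0 ≤ 1) (h : pathProb p l ≠ 0) : SkipFree l :=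
  fun _ ha => hp _ (apply_ne_zero_of_pathProb_ne_zero h ha)

theorem FirstPassage.eq_of_prefix (h : FirstPassage s n l) (h' : FirstPassage s n l')
    (hl : l <+: l') : l = l' := by
  obtain ⟨c, rfl⟩ := hl
  by_contra hne
  have hc : c ≠ [] := by rintro rfl; simp at hne
  exact (h'.2 _ (add_sum_mem_sites_append hc)).ne h.1

theorem FirstPassage.exists_append_of_le (hmn : m ≤ n) (h : FirstPassage s m l)
    (h' : FirstPassage s n l') (e : l ++ l₂ = l' ++ l₂') : ∃ c, l' = l ++ c ∧ l₂ = c ++ l₂' := by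
  rcases List.append_eq_append_iff.1 e with ⟨c, h1, h2⟩ | ⟨c, h1, h2⟩
  · exact ⟨c, h1, h2⟩
  · rcases eq_or_ne c [] with rfl | hc
    · exact ⟨[], by simpa using h1.symm, by simpa using h2.symm⟩
    · have := h.2 (s + l'.sum) (by rw [h1]; exact add_sum_mem_sites_append hc)
      rw [h'.1] at this
      omega

theorem FirstPassage.append (hmn : m ≤ n) (h : FirstPassage s m l)
    (h₂ : FirstPassage (s + l.sum) n l₂) : FirstPassage s n (l ++ l₂) := by
  refine ⟨by rw [List.sum_append, ← add_assoc]; exact h₂.1, fun x hx => ?_⟩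
  rw [sites_append, List.mem_append] at hx
  exact hx.elim (fun hx => (h.2 x hx).trans_le hmn) (h₂.2 x)

theorem FirstPassage.of_append (h : FirstPassage s n (l ++ l₂)) :
    FirstPassage (s + l.sum) n l₂ := by
  refine ⟨by rw [add_assoc, ← List.sum_append]; exact h.1, fun x hx => h.2 x ?_⟩
  rw [sites_append]
  exact List.mem_append_right _ hx

theorem firstPassage_iff_sub : FirstPassage s n l ↔ FirstPassage 0 (n - s 0) l := by
  refine and_congr (by simp only [Pi.add_apply, Pi.zero_apply]; omega) ⟨fun h x hx => ?_,
    fun h x hx => ?_⟩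
  · have := h (x + s) (add_mem_sites_iff.2 hx)
    simp only [Pi.add_apply] at this
    omega
  · have := h _ (mem_sites_iff_sub_mem.1 hx)
    simp only [Pi.sub_apply] at this
    omega

theorem SkipFree.exists_firstPassage (hl : SkipFree l) (hs : s 0 ≤ m) (he : m ≤ (s + l.sum) 0) :
    ∃ l₁ l₂, l = l₁ ++ l₂ ∧ FirstPassage s m l₁ := by
  induction l generalizing s with
  | nil =>
    refine ⟨[], [], rfl, ?_, by simp⟩
    simp only [List.sum_nil, add_zero] at he ⊢
    omega
  | cons a l ih =>
    rcases hs.eq_or_lt with h | h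
    · exact ⟨[], a :: l, rfl, by simpa using h, by simp⟩
    · have ha : a 0 ≤ 1 := hl a (by simp)
      obtain ⟨l₁, l₂, rfl, h1⟩ := ih (s := s + a) (fun b hb => hl b (by simp [hb]))
        (by simp only [Pi.add_apply]; omega) (by simpa [add_assoc] using he)
      exact ⟨a :: l₁, l₂, rfl, by simpa [add_assoc] using h1.1, by simpa using ⟨h, h1.2⟩⟩

theorem SkipFree.exists_last_visit_zero (hl : SkipFree l) (hx : ∃ x ∈ sites s l, x 0 ≤ 0)
    (he : 1 ≤ (s + l.sum) 0) :
    ∃ l₁ a l₂, l = l₁ ++ a :: l₂ ∧ (s + l₁.sum) 0 = 0 ∧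
      ∀ x ∈ sites (s + l₁.sum + a) l₂, 1 ≤ x 0 := by
  induction l generalizing s with
  | nil => simp at hx
  | cons a l ih =>
    by_cases h : ∃ x ∈ sites (s + a) l, x 0 ≤ 0
    · obtain ⟨l₁, b, l₂, rfl, h1, h2⟩ := ih (s := s + a) (fun b hb => hl b (by simp [hb])) h
        (by simpa [add_assoc] using he)
      exact ⟨a :: l₁, b, l₂, rfl, by simpa [add_assoc] using h1, by simpa [add_assoc] using h2⟩
    · push Not at h
      have ha : a 0 ≤ 1 := hl a (by simp)
      have hs : s 0 ≤ 0 := by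
        obtain ⟨x, hx, hx0⟩ := hx
        rcases List.mem_cons.1 hx with rfl | hx
        · exact hx0
        · exact absurd hx0 (h x hx).not_ge
      have h1 : 1 ≤ (s + a) 0 := by
        cases l with
        | nil => simpa using he
        | cons b l => exact h (s + a) (by simp)
      simp only [Pi.add_apply] at h1
      refine ⟨[], a, l, rfl, ?_, fun x hx => h x (by simpa using hx)⟩
      simp only [List.sum_nil, add_zero]
      omega

theorem exists_first_visit_zero (he : (s + l.sum) 0 = 0) :
    ∃ l₁ l₂, l = l₁ ++ l₂ ∧ (s + l₁.sum) 0 = 0 ∧ ∀ x ∈ sites s l₁, x 0 ≠ 0 := by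
  induction l generalizing s with
  | nil => exact ⟨[], [], rfl, he, by simp⟩
  | cons a l ih =>
    by_cases h : s 0 = 0
    · exact ⟨[], a :: l, rfl, by simpa using h, by simp⟩
    · obtain ⟨l₁, l₂, rfl, h1, h2⟩ := ih (s := s + a) (by simpa [add_assoc] using he)
      exact ⟨a :: l₁, l₂, rfl, by simpa [add_assoc] using h1, by simpa using ⟨h, h2⟩⟩

theorem Separates.append (h : Separates s l m) (h₂ : ∀ x ∈ sites (s + l.sum) l₂, m ≤ x 0) :
    Separates s (l ++ l₂) m := by
  obtain ⟨a, b, rfl, ha, hb⟩ := h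
  refine ⟨a, b ++ l₂, by simp, ha, fun x hx => ?_⟩
  rw [sites_append, List.mem_append] at hx
  refine hx.elim (hb x) fun hx => h₂ x ?_
  rwa [List.sum_append, ← add_assoc]

theorem FirstPassage.separates (h : FirstPassage s n l) : Separates s l n :=
  ⟨l, [], by simp, h, by simp⟩

theorem FirstPassage.separates_of_append_eq (hmn : m ≤ n) (h : FirstPassage s m l)
    (h' : FirstPassage s n l') (e : l ++ l₂ = l' ++ l₂')
    (hs : ∀ x ∈ sites (s + l.sum) l₂, m ≤ x 0) : Separates s l' m := by
  obtain ⟨c, rfl, rfl⟩ := h.exists_append_of_le hmn h' e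
  refine ⟨l, c, rfl, h, fun x hx => hs x ?_⟩
  rw [sites_append]
  exact List.mem_append_left _ hx

end FirstPassage

section Upward

variable {d : ℕ} [NeZero d] {s z x : Lattice d} {j k m n : ℕ} {A : Set ℕ}
  {l l₂ l' l₂' : List (Lattice d)}

theorem Upward.level_mem_Ico (h : Upward n l) (hx : x ∈ sites z l) :
    x 0 ∈ Set.Ico (z 0) (z 0 + n) := by
  have hx := mem_sites_iff_sub_mem.1 hx
  have h1 := h.1.2 _ hx
  have h2 := h.2 _ hx
  simp only [Pi.sub_apply] at h1 h2
  exact ⟨by omega, by omega⟩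

theorem Upward.firstPassage (h : Upward n l) (z : Lattice d) : FirstPassage z (z 0 + n) l := by
  rw [firstPassage_iff_sub, add_sub_cancel_left]
  exact h.1

theorem FirstPassage.upward {n : ℤ} (h : FirstPassage z n l) (hj : z 0 + j = n)
    (hl : ∀ x ∈ sites z l, z 0 ≤ x 0) : Upward j l := by
  refine ⟨by rwa [firstPassage_iff_sub, ← hj, add_sub_cancel_left] at h, fun x hx => ?_⟩
  have := hl (x + z) (add_mem_sites_iff.2 hx)
  simp only [Pi.add_apply] at this
  omega

theorem FirstPassage.append_upward (h : FirstPassage s m l) (h₂ : Upward j l₂) (hn : m + j = n) :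
    FirstPassage s n (l ++ l₂) := by
  refine h.append (by omega) ?_
  have := h₂.firstPassage (s + l.sum)
  rwa [h.1, ← Nat.cast_add, hn] at this

theorem Upward.append (h : Upward m l) (h₂ : Upward j l₂) (hn : m + j = n) :
    Upward n (l ++ l₂) := by
  refine ⟨h.1.append_upward h₂ hn, fun x hx => ?_⟩
  rw [sites_append, List.mem_append] at hx
  refine hx.elim (h.2 x) fun hx => le_trans ?_ (h₂.level_mem_Ico hx).1
  rw [h.1.1]
  positivity

theorem Unseparated.not_lt_of_append_eq (h : Unseparated A s m l) (hm : m ∈ A)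
    (h₂ : Upward j l₂) (h' : Unseparated A s n l') (e : l ++ l₂ = l' ++ l₂') : ¬ m < n := by
  intro hlt
  refine h'.2 m hm hlt (h.1.separates_of_append_eq (by exact_mod_cast hlt.le) h'.1 e fun x hx => ?_)
  rw [← h.1.1]
  exact (h₂.level_mem_Ico hx).1

theorem Unseparated.eq_of_append_eq (h : Unseparated A s m l) (hm : m ∈ A) (h₂ : Upward j l₂)
    (h' : Unseparated A s n l') (hn : n ∈ A) (h₂' : Upward k l₂') (e : l ++ l₂ = l' ++ l₂') :
    m = n ∧ l = l' ∧ l₂ = l₂' := by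
  obtain rfl : m = n := le_antisymm
    (not_lt.1 (h'.not_lt_of_append_eq hn h₂' h e.symm))
    (not_lt.1 (h.not_lt_of_append_eq hm h₂ h' e))
  obtain ⟨c, hc, -⟩ := h.1.exists_append_of_le le_rfl h'.1 e
  obtain rfl : l = l' := h.1.eq_of_prefix h'.1 ⟨c, hc.symm⟩
  exact ⟨rfl, rfl, List.append_cancel_left e⟩

theorem IsBlock.unseparated (h : IsBlock k l) : Unseparated {j | 0 < j} 0 k l := ⟨h.1.1, h.2⟩

theorem Upward.exists_isBlock (h : Upward n l) (hn : 0 < n) :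
    ∃ k ∈ Finset.Icc 1 n, ∃ l₁ l₂, l = l₁ ++ l₂ ∧ IsBlock k l₁ ∧ Upward (n - k) l₂ := by
  classical
  have hex : ∃ j : ℕ, 0 < j ∧ Separates (0 : Lattice d) l j := ⟨n, hn, h.1.separates⟩
  obtain ⟨h0, l₁, l₂, hl, h1, h2⟩ := Nat.find_spec hex
  have hle : Nat.find hex ≤ n := Nat.find_min' hex ⟨hn, h.1.separates⟩
  have hmin : ∀ i < Nat.find hex, ¬ _ := fun i hi => Nat.find_min hex hi
  generalize Nat.find hex = k at h0 h1 h2 hle hmin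
  subst hl
  refine ⟨k, Finset.mem_Icc.2 ⟨h0, hle⟩, l₁, l₂, rfl, ⟨⟨h1, fun x hx => h.2 x ?_⟩, ?_⟩, ?_⟩
  · rw [sites_append]
    exact List.mem_append_left _ hx
  · refine fun i hi hik hsep => hmin i hik ⟨hi, hsep.append fun x hx => ?_⟩
    have := h2 x hx
    omega
  · exact h.1.of_append.upward (by rw [h1.1]; omega) fun x hx => h1.1 ▸ h2 x hx

end Upward

section PathWeight

variable {d : ℕ}

/-- The probability that a walk from `s` starts with the steps `l` and that the constraints at the
levels `≥ 0` allow it: no other constraint counts in `P_0` and in the renewal structure. -/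
def pathWeight (p : Lattice d → ℝ≥0∞) (G : ℕ → ℝ≥0∞) [NeZero d] (s : Lattice d)
    (l : List (Lattice d)) : ℝ≥0∞ :=
  pathProb p l * allowProb G ((sites s l).filter fun x => 0 ≤ x 0)

open Classical in
/-- The total weight of the paths from `s` in the family `K`. -/
def totalWeight (p : Lattice d → ℝ≥0∞) (G : ℕ → ℝ≥0∞) [NeZero d] (s : Lattice d)
    (K : List (Lattice d) → Prop) : ℝ≥0∞ :=
  ∑' l, if K l then pathWeight p G s l else 0

/-- The probability of reaching level `n` from the origin without going below level `0`. -/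
def climbProb (p : Lattice d → ℝ≥0∞) (G : ℕ → ℝ≥0∞) [NeZero d] (n : ℕ) : ℝ≥0∞ :=
  totalWeight p G 0 (Upward n)

/-- The probability that `k` is the first separating level after `0` of the path from the origin. -/
def blockProb (p : Lattice d → ℝ≥0∞) (G : ℕ → ℝ≥0∞) [NeZero d] (k : ℕ) : ℝ≥0∞ :=
  totalWeight p G 0 (IsBlock k)

variable [NeZero d] {p : Lattice d → ℝ≥0∞} {G : ℕ → ℝ≥0∞} {s z : Lattice d}
  {l l₂ : List (Lattice d)} {K : List (Lattice d) → Prop}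

theorem totalWeight_mono {K' : List (Lattice d) → Prop} (h : ∀ l, K l → K' l) :
    totalWeight p G s K ≤ totalWeight p G s K' := by
  refine ENNReal.tsum_le_tsum fun l => ?_
  split_ifs with h1 h2
  · exact le_rfl
  · exact absurd (h l h1) h2
  · exact bot_le
  · exact le_rfl

theorem totalWeight_mul_totalWeight (s s' : Lattice d) (K K' : List (Lattice d) → Prop) :
    totalWeight p G s K * totalWeight p G s' K' = ∑' x : List (Lattice d) × List (Lattice d),
      open Classical in
        if K x.1 ∧ K' x.2 then pathWeight p G s x.1 * pathWeight p G s' x.2 else 0 := by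
  classical
  unfold totalWeight
  rw [tsum_mul_tsum]
  refine tsum_congr fun x => ?_
  by_cases h : K x.1 <;> by_cases h' : K' x.2 <;> simp [h, h']

theorem Upward.filter_sites {n : ℕ} (h : Upward n l) (hz : 0 ≤ z 0) :
    ((sites z l).filter fun x => 0 ≤ x 0) = sites z l :=
  List.filter_eq_self.2 fun _ hx => by simpa using hz.trans (h.level_mem_Ico hx).1

/-- The two parts of the path visit disjoint sets of levels, hence meet independent constraints. -/
theorem pathWeight_append {m j : ℕ} (h : FirstPassage s m l) (h₂ : Upward j l₂) :
    pathWeight p G s (l ++ l₂) = pathWeight p G s l * pathWeight p G 0 l₂ := by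
  have hz : 0 ≤ (s + l.sum) 0 := by rw [h.1]; positivity
  have hd : ((sites s l).filter fun x => 0 ≤ x 0).Disjoint (sites (s + l.sum) l₂) := by
    intro x hx hx'
    have h1 := h.2 x (List.mem_of_mem_filter hx)
    have h2 := (h₂.level_mem_Ico hx').1
    rw [h.1] at h2
    omega
  unfold pathWeight
  rw [pathProb_append, sites_append, List.filter_append, h₂.filter_sites hz,
    h₂.filter_sites le_rfl, allowProb_append hd, allowProb_sites (s + l.sum)]
  ring

theorem climbProb_zero : climbProb p G 0 = 1 := by
  classical
  unfold climbProb totalWeight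
  rw [tsum_eq_single []]
  · rw [if_pos ⟨⟨by simp, by simp⟩, by simp⟩]
    simp [pathWeight]
  · intro l hl
    obtain ⟨a, l, rfl⟩ := List.exists_cons_of_ne_nil hl
    exact if_neg fun h => by simpa using h.1.2 0 (by simp)

section Concatenation

variable {A : Set ℕ} {I : Finset ℕ} {n : ℕ} {F : ℕ → List (Lattice d) → Prop}

theorem sum_totalWeight_mul_climbProb (hF : ∀ m l, F m l → Unseparated A s m l) :
    ∑ m ∈ I, totalWeight p G s (F m) * climbProb p G (n - m) =
      ∑' x : I × (List (Lattice d) × List (Lattice d)),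
        open Classical in if F x.1 x.2.1 ∧ Upward (n - x.1) x.2.2 then
          pathWeight p G s (x.2.1 ++ x.2.2) else 0 := by
  classical
  rw [ENNReal.tsum_prod', ← Finset.tsum_subtype]
  refine tsum_congr fun m => ?_
  rw [climbProb, totalWeight_mul_totalWeight]
  refine tsum_congr fun x => if_ctx_congr Iff.rfl (fun h => ?_) fun _ => rfl
  rw [pathWeight_append (hF _ _ h.1).1 h.2]

theorem sum_totalWeight_mul_climbProb_le (hA : ∀ m ∈ I, m ∈ A)
    (hF : ∀ m l, F m l → Unseparated A s m l)
    (hK : ∀ m ∈ I, ∀ l l₂, F m l → Upward (n - m) l₂ → K (l ++ l₂)) :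
    ∑ m ∈ I, totalWeight p G s (F m) * climbProb p G (n - m) ≤ totalWeight p G s K := by
  classical
  rw [sum_totalWeight_mul_climbProb hF]
  refine tsum_le_tsum_of_injOn (fun x => x.2.1 ++ x.2.2) ?_ ?_
  · rintro ⟨m, l, l₂⟩ h ⟨m', l', l₂'⟩ h' e
    rw [Function.mem_support, ne_eq, ite_eq_right_iff, Classical.not_imp] at h h'
    obtain ⟨hm, hl, hl₂⟩ := (hF _ _ h.1.1).eq_of_append_eq (hA m m.2) h.1.2 (hF _ _ h'.1.1)
      (hA m' m'.2) h'.1.2 e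
    exact Prod.ext (Subtype.ext hm) (Prod.ext hl hl₂)
  · rintro ⟨m, l, l₂⟩ h
    rw [ne_eq, ite_eq_right_iff, Classical.not_imp] at h
    rw [if_pos h.1, if_pos (hK m m.2 l l₂ h.1.1 h.1.2)]

theorem le_sum_totalWeight_mul_climbProb (hF : ∀ m l, F m l → Unseparated A s m l)
    (hK : ∀ l, K l → ∃ m ∈ I, ∃ l₁ l₂, l = l₁ ++ l₂ ∧ F m l₁ ∧ Upward (n - m) l₂) :
    totalWeight p G s K ≤ ∑ m ∈ I, totalWeight p G s (F m) * climbProb p G (n - m) := by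
  classical
  rw [sum_totalWeight_mul_climbProb hF, totalWeight]
  refine tsum_le_tsum_of_exists_preimage (fun x => x.2.1 ++ x.2.2) fun l h => ?_
  rw [ne_eq, ite_eq_right_iff, Classical.not_imp] at h
  obtain ⟨m, hm, l₁, l₂, rfl, h₁, h₂⟩ := hK l h.1
  refine ⟨⟨⟨m, hm⟩, l₁, l₂⟩, rfl, ?_⟩
  rw [if_pos h.1, if_pos ⟨h₁, h₂⟩]

end Concatenation

theorem sum_unseparated_mul_climbProb_le (n : ℕ) (s : Lattice d) :
    ∑ m ∈ Finset.range (n + 1),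
        totalWeight p G s (Unseparated Set.univ s m) * climbProb p G (n - m) ≤
      totalWeight p G s (FirstPassage s n) := by
  refine sum_totalWeight_mul_climbProb_le (A := Set.univ) (by simp) (fun _ _ h => h) ?_
  intro m hm l l₂ h h₂
  exact h.1.append_upward h₂ (Nat.add_sub_cancel' (Finset.mem_range_succ_iff.1 hm))

theorem climbProb_eq_sum_blockProb {n : ℕ} (hn : 0 < n) :
    climbProb p G n = ∑ k ∈ Finset.Icc 1 n, blockProb p G k * climbProb p G (n - k) := by
  refine le_antisymm ?_ ?_
  · exact le_sum_totalWeight_mul_climbProb (fun _ _ h => h.unseparated)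
      fun l h => h.exists_isBlock hn
  · refine sum_totalWeight_mul_climbProb_le (A := {j | 0 < j})
      (fun m hm => (Finset.mem_Icc.1 hm).1) (fun _ _ h => h.unseparated) fun m hm l l₂ h h₂ => ?_
    exact h.1.append h₂ (Nat.add_sub_cancel' (Finset.mem_Icc.1 hm).2)

end PathWeight

/-! ### Submultiplicativity and the Green function of a level -/

section LevelGreen

variable {d : ℕ} [NeZero d] {p : Lattice d → ℝ≥0∞} {G : ℕ → ℝ≥0∞} {s z : Lattice d}
  {l l₁ l₂ : List (Lattice d)}

/-- The successive sites on level `0` visited by the path from `s`, its endpoint excluded. -/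
def levelVisits (s : Lattice d) (l : List (Lattice d)) : List (Lattice d) :=
  (sites s l).filter fun x => x 0 = 0

/-- The probability that a walk from `s` starts with the steps `l` and that the constraints on
level `0` allow it. -/
def levelWeight (p : Lattice d → ℝ≥0∞) (G : ℕ → ℝ≥0∞) (s : Lattice d) (l : List (Lattice d)) :
    ℝ≥0∞ :=
  pathProb p l * allowProb G (levelVisits s l)

open Classical in
/-- The expected number of visits of level `0` that the constraints on that level allow. -/
def levelGreen (p : Lattice d → ℝ≥0∞) (G : ℕ → ℝ≥0∞) (s : Lattice d) : ℝ≥0∞ :=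
  ∑' l : List (Lattice d), if (s + l.sum) 0 = 0 then levelWeight p G s l else 0

/-- The path from `s` ends at its first visit to level `0`. -/
def FirstVisit (s : Lattice d) (l : List (Lattice d)) : Prop :=
  (s + l.sum) 0 = 0 ∧ ∀ x ∈ sites s l, x 0 ≠ 0

/-- A nonempty path that ends at its first return to its initial level. -/
def IsExcursion (l : List (Lattice d)) : Prop :=
  l ≠ [] ∧ l.sum 0 = 0 ∧ ∀ x ∈ (sites 0 l).tail, x 0 ≠ 0

theorem allowProb_filter_append_le (h0 : G 0 = 1) (hG : Antitone G) {α : Type*} [DecidableEq α]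
    {M M' : List α} {A B C : α → Prop} [DecidablePred A] [DecidablePred B] [DecidablePred C]
    (hA : ∀ x, A x → C x) (hB : ∀ x, B x → C x) (hAB : ∀ x, A x → ¬ B x) :
    allowProb G ((M ++ M').filter fun x => C x) ≤
      allowProb G (M.filter fun x => A x) * allowProb G (M'.filter fun x => B x) := by
  have hdisj : (M.filter fun x => A x).Disjoint (M'.filter fun x => B x) := fun x hx hx' =>
    hAB x (by simpa using List.of_mem_filter hx) (by simpa using List.of_mem_filter hx')
  rw [← allowProb_append hdisj, List.filter_append]
  refine allowProb_anti h0 hG fun y => ?_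
  rw [List.count_append, List.count_append]
  exact add_le_add ((List.monotone_filter_right M (by simpa using hA)).count_le y)
    ((List.monotone_filter_right M' (by simpa using hB)).count_le y)

theorem levelWeight_eq_zero_start (hz : z 0 = 0) (l : List (Lattice d)) :
    levelWeight p G z l = levelWeight p G 0 l := by
  rw [levelWeight, levelVisits, allowProb_filter_sites]
  simp only [Pi.add_apply, hz, add_zero]
  rfl

theorem levelWeight_append_le (h0 : G 0 = 1) (hG : Antitone G) (hz : (s + l₁.sum) 0 = 0) :
    levelWeight p G s (l₁ ++ l₂) ≤ pathProb p l₁ * levelWeight p G 0 l₂ := by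
  rw [← levelWeight_eq_zero_start hz l₂, levelWeight, levelWeight, pathProb_append, mul_assoc,
    levelVisits, sites_append, List.filter_append]
  gcongr
  refine allowProb_anti h0 hG fun x => ?_
  rw [List.count_append]
  exact Nat.le_add_left _ _

theorem levelGreen_le_mul_levelGreen_zero (h0 : G 0 = 1) (hG : Antitone G) (s : Lattice d) :
    levelGreen p G s ≤
      (∑' l, open Classical in if FirstVisit s l then pathProb p l else 0) *
        levelGreen p G 0 := by
  classical
  unfold levelGreen
  rw [tsum_mul_tsum]
  refine tsum_le_tsum_of_exists_preimage (fun x => x.1 ++ x.2) fun l h => ?_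
  rw [ne_eq, ite_eq_right_iff, Classical.not_imp] at h
  obtain ⟨l₁, l₂, rfl, h1, h2⟩ := exists_first_visit_zero h.1
  have hl₂ : (0 + l₂.sum) 0 = 0 := by
    have := h.1
    simp only [List.sum_append, Pi.add_apply, Pi.zero_apply] at this h1 ⊢
    omega
  refine ⟨(l₁, l₂), rfl, ?_⟩
  rw [if_pos h.1, if_pos ⟨h1, h2⟩, if_pos hl₂]
  exact levelWeight_append_le h0 hG h1

theorem FirstPassage.exists_upward {n : ℕ} (hl : SkipFree l) (hs : s 0 ≤ 0)
    (h : FirstPassage s n l) :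
    ∃ l₁ l₂, l = l₁ ++ l₂ ∧ (s + l₁.sum) 0 = 0 ∧ Upward n l₂ ∧
      ∀ x ∈ (sites (s + l₁.sum) l₂).tail, 1 ≤ x 0 := by
  rcases Nat.eq_zero_or_pos n with rfl | hn
  · exact ⟨l, [], by simp, h.1, ⟨⟨by simp, by simp⟩, by simp⟩, by simp⟩
  have hex : ∃ x ∈ sites s l, x 0 ≤ 0 := by
    cases l with
    | nil =>
      have := h.1
      simp only [List.sum_nil, add_zero] at this
      omega
    | cons a l => exact ⟨s, by simp, hs⟩
  obtain ⟨l₁, a, l₂, rfl, hz, h2⟩ := hl.exists_last_visit_zero hex (by rw [h.1]; omega)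
  refine ⟨l₁, a :: l₂, rfl, hz, h.of_append.upward (by rw [hz, zero_add]) fun x hx => ?_, h2⟩
  rcases List.mem_cons.1 hx with rfl | hx
  · exact le_rfl
  · have := h2 x hx
    omega

theorem Upward.allowProb_filter_sites_pos (h1 : G 1 = 1) {n : ℕ} (h : Upward n l) (hz : z 0 = 0)
    (hpos : ∀ x ∈ (sites z l).tail, 1 ≤ x 0) :
    allowProb G ((sites z l).filter fun x => 1 ≤ x 0) =
      allowProb G ((sites 0 l).filter fun x => 0 ≤ x 0) := by
  rw [h.filter_sites le_rfl, ← allowProb_sites z]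
  cases l with
  | nil => rfl
  | cons a l =>
    have hz_notMem : z ∉ sites (z + a) l := fun hx => by
      have := hpos z hx
      omega
    rw [sites_cons, List.filter_cons_of_neg (by simp [hz]), List.filter_eq_self.2
      fun x hx => by simpa using hpos x hx, allowProb_cons_of_notMem h1 hz_notMem]

/-- Cut at the last visit to level `0`: `G 1 = 1` makes the constraint at the starting site of the
second part void, so that the constraints of the two parts sit on different levels. -/
theorem totalWeight_firstPassage_le (hp : ∀ a : Lattice d, p a ≠ 0 → a 0 ≤ 1) (h0 : G 0 = 1)
    (h1 : G 1 = 1) (hG : Antitone G) (hs : s 0 ≤ 0) (n : ℕ) :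
    totalWeight p G s (FirstPassage s n) ≤ levelGreen p G s * climbProb p G n := by
  classical
  unfold levelGreen climbProb totalWeight
  rw [tsum_mul_tsum]
  refine tsum_le_tsum_of_exists_preimage (fun x => x.1 ++ x.2) fun l h => ?_
  rw [ne_eq, ite_eq_right_iff, Classical.not_imp] at h
  obtain ⟨l₁, l₂, rfl, hz, hu, hpos⟩ :=
    h.1.exists_upward (.of_pathProb_ne_zero hp (left_ne_zero_of_mul h.2)) hs
  refine ⟨(l₁, l₂), rfl, ?_⟩
  rw [if_pos h.1, if_pos hz, if_pos hu, pathWeight, pathWeight, levelWeight, pathProb_append,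
    sites_append, mul_mul_mul_comm, ← hu.allowProb_filter_sites_pos h1 hz hpos]
  gcongr
  exact allowProb_filter_append_le h0 hG (fun x hx => hx.ge) (fun x hx => by omega)
    fun x hx => by omega

theorem Upward.exists_append {a b : ℕ} (hl : SkipFree l) (h : Upward (a + b) l) :
    ∃ l₁ l₂, l = l₁ ++ l₂ ∧ Upward a l₁ ∧ FirstPassage 0 b l₂ := by
  obtain ⟨l₁, l₂, rfl, h1⟩ :=
    hl.exists_firstPassage (s := 0) (m := a) (by simp) (by rw [h.1.1]; simp)
  refine ⟨l₁, l₂, rfl, ⟨h1, fun x hx => h.2 x ?_⟩, ?_⟩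
  · rw [sites_append]
    exact List.mem_append_left _ hx
  · have h2 := h.1.of_append
    rw [firstPassage_iff_sub, h1.1] at h2
    simpa using h2

theorem pathWeight_append_le (h0 : G 0 = 1) (hG : Antitone G) {a : ℕ} (h : Upward a l₁) :
    pathWeight p G 0 (l₁ ++ l₂) ≤ pathWeight p G 0 l₁ * pathWeight p G 0 l₂ := by
  have hbelow : ((sites 0 l₁).filter fun x => 0 ≤ x 0) =
      (sites 0 l₁).filter fun x => 0 ≤ x 0 ∧ x 0 < (a : ℤ) :=
    List.filter_congr fun x hx => by simp [h.1.2 x hx]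
  have habove : allowProb G ((sites 0 l₂).filter fun x => 0 ≤ x 0) =
      allowProb G ((sites (0 + l₁.sum) l₂).filter fun x => (a : ℤ) ≤ x 0) := by
    have hend : (0 + l₁.sum) 0 = (a : ℤ) := h.1.1
    rw [allowProb_filter_sites _ (0 + l₁.sum)]
    simp only [Pi.add_apply _ (0 + l₁.sum), hend, le_add_iff_nonneg_left]
  rw [pathWeight, pathWeight, pathWeight, pathProb_append, sites_append, mul_mul_mul_comm, hbelow,
    habove]
  gcongr
  exact allowProb_filter_append_le h0 hG (fun x hx => hx.1) (fun x hx => by omega)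
    fun x hx => by omega

theorem climbProb_add_le (hp : ∀ a : Lattice d, p a ≠ 0 → a 0 ≤ 1) (h0 : G 0 = 1)
    (hG : Antitone G) (a b : ℕ) :
    climbProb p G (a + b) ≤ climbProb p G a * totalWeight p G 0 (FirstPassage 0 b) := by
  classical
  unfold climbProb
  rw [totalWeight_mul_totalWeight, totalWeight]
  refine tsum_le_tsum_of_exists_preimage (fun x => x.1 ++ x.2) fun l h => ?_
  rw [ne_eq, ite_eq_right_iff, Classical.not_imp] at h
  obtain ⟨l₁, l₂, rfl, h1, h2⟩ :=
    h.1.exists_append (.of_pathProb_ne_zero hp (left_ne_zero_of_mul h.2))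
  refine ⟨(l₁, l₂), rfl, ?_⟩
  rw [if_pos h.1, if_pos ⟨h1, h2⟩]
  exact pathWeight_append_le h0 hG h1

end LevelGreen

/-! ### The walk induced on a level -/

section InducedWalk

/-- The expectation of `F` over `j` independent steps with (sub-)distribution `ρ`. -/
def expect {α : Type*} (ρ : α → ℝ≥0∞) : ℕ → (List α → ℝ≥0∞) → ℝ≥0∞
  | 0, F => F []
  | j + 1, F => ∑' y, ρ y * expect ρ j fun l => F (y :: l)

variable {d : ℕ} [NeZero d] {p : Lattice d → ℝ≥0∞} {G : ℕ → ℝ≥0∞} {s : Lattice d}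
  {l : List (Lattice d)}

open Classical in
/-- The distribution of the displacement between consecutive visits of level `0`; it is defective
when the walk may fail to return to that level. -/
def excursionLaw (p : Lattice d → ℝ≥0∞) (y : Lattice d) : ℝ≥0∞ :=
  ∑' l : List (Lattice d), if IsExcursion l ∧ l.sum = y then pathProb p l else 0

theorem tsum_excursionLaw_mul (g : Lattice d → ℝ≥0∞) :
    ∑' y, excursionLaw p y * g y =
      ∑' l : List (Lattice d), open Classical in
        if IsExcursion l then pathProb p l * g l.sum else 0 := by
  classical
  unfold excursionLaw
  simp_rw [← ENNReal.tsum_mul_right]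
  rw [ENNReal.tsum_comm]
  refine tsum_congr fun l => ?_
  rw [tsum_eq_single l.sum]
  · simp
  · intro y hy
    rw [if_neg (fun h => hy h.2.symm), zero_mul]

theorem exists_excursion_append (hs : s 0 = 0) (hl : l.sum 0 = 0) (hne : l ≠ []) :
    ∃ l₁ l₂, l = l₁ ++ l₂ ∧ IsExcursion l₁ ∧
      levelVisits s l = s :: levelVisits (s + l₁.sum) l₂ := by
  obtain ⟨a, l, rfl⟩ := List.exists_cons_of_ne_nil hne
  obtain ⟨l₁, l₂, rfl, h1, h2⟩ := exists_first_visit_zero (s := a) (l := l) (by simpa using hl)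
  refine ⟨a :: l₁, l₂, rfl, ⟨by simp, by simpa using h1, by simpa using h2⟩, ?_⟩
  have hnone : (sites (s + a) l₁).filter (fun x => x 0 = 0) = [] := by
    refine List.filter_eq_nil_iff.2 fun x hx => ?_
    have hmem : x - s ∈ sites a l₁ := by
      rw [mem_sites_iff_sub_mem, sub_sub]
      exact mem_sites_iff_sub_mem.1 hx
    simpa [hs] using h2 _ hmem
  rw [levelVisits, sites_cons, List.filter_cons_of_pos (by simp [hs]), sites_append,
    List.filter_append, hnone]
  simp [add_assoc, levelVisits]

theorem tsum_levelVisits_length_eq_le (j : ℕ) (hs : s 0 = 0) (F : List (Lattice d) → ℝ≥0∞) :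
    ∑' l : List (Lattice d), (open Classical in
      if l.sum 0 = 0 ∧ (levelVisits s l).length = j then pathProb p l * F (levelVisits s l)
      else 0) ≤ expect (excursionLaw p) j fun L => F (sites s L) := by
  classical
  induction j generalizing s F with
  | zero =>
    refine (tsum_eq_single [] fun l hl => if_neg ?_).le.trans (by simp [expect, levelVisits])
    obtain ⟨a, l, rfl⟩ := List.exists_cons_of_ne_nil hl
    simp [levelVisits, hs]
  | succ j ih =>
    rw [expect, tsum_excursionLaw_mul]
    calc _ ≤ ∑' x : List (Lattice d) × List (Lattice d),
          if IsExcursion x.1 then pathProb p x.1 *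
            (if x.2.sum 0 = 0 ∧ (levelVisits (s + x.1.sum) x.2).length = j then
              pathProb p x.2 * F (s :: levelVisits (s + x.1.sum) x.2) else 0) else 0 := ?_
      _ ≤ _ := ?_
    · refine tsum_le_tsum_of_exists_preimage (fun x => x.1 ++ x.2) fun l h => ?_
      rw [ne_eq, ite_eq_right_iff, Classical.not_imp] at h
      obtain ⟨⟨hl, hc⟩, -⟩ := h
      obtain ⟨l₁, l₂, rfl, h1, h2⟩ :=
        exists_excursion_append hs hl (by rintro rfl; simp [levelVisits] at hc)
      have hl₂ : l₂.sum 0 = 0 := by simpa [h1.2.1] using hl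
      refine ⟨(l₁, l₂), rfl, ?_⟩
      rw [if_pos ⟨hl, hc⟩, if_pos h1, if_pos ⟨hl₂, by simpa [h2] using hc⟩, pathProb_append,
        mul_assoc, h2]
    · rw [ENNReal.tsum_prod']
      refine ENNReal.tsum_le_tsum fun l => ?_
      dsimp only
      split_ifs with h
      · rw [ENNReal.tsum_mul_left]
        gcongr
        exact ih (by simp [hs, h.2.1]) fun M => F (s :: M)
      · simp

theorem levelGreen_zero_le :
    levelGreen p G 0 ≤ ∑' j, expect (excursionLaw p) j fun L => allowProb G (sites 0 L) := by
  classical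
  refine le_trans ?_ (ENNReal.tsum_le_tsum fun j =>
    tsum_levelVisits_length_eq_le j (s := 0) rfl (allowProb G))
  rw [ENNReal.tsum_comm]
  refine ENNReal.tsum_le_tsum fun l => ?_
  refine le_trans ?_ (ENNReal.le_tsum (levelVisits 0 l).length)
  simp [levelWeight]

end InducedWalk

/-! ### Concentration of binomial coefficients -/

section Binomial

theorem centralBinom_sq_mul_le (n : ℕ) : n.centralBinom ^ 2 * (2 * n + 1) ≤ 16 ^ n := by
  induction n with
  | zero => simp
  | succ n ih =>
    have hrec := Nat.succ_mul_centralBinom_succ n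
    have hscaled : (n + 1) ^ 2 * ((n + 1).centralBinom ^ 2 * (2 * (n + 1) + 1)) ≤
        (n + 1) ^ 2 * 16 ^ (n + 1) := by
      calc _ = ((n + 1) * (n + 1).centralBinom) ^ 2 * (2 * n + 3) := by ring
        _ = 4 * ((2 * n + 1) * (2 * n + 3)) * (n.centralBinom ^ 2 * (2 * n + 1)) := by
          rw [hrec]; ring
        _ ≤ 4 * (4 * (n + 1) ^ 2) * 16 ^ n :=
          Nat.mul_le_mul (Nat.mul_le_mul_left 4 (by nlinarith)) ih
        _ = _ := by ring
    exact Nat.le_of_mul_le_mul_left hscaled (by positivity)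

theorem choose_half_sq_mul_le (i : ℕ) : (i.choose (i / 2)) ^ 2 * (i + 1) ≤ 4 ^ i := by
  rcases Nat.even_or_odd' i with ⟨n, rfl | rfl⟩
  · have h := centralBinom_sq_mul_le n
    rw [Nat.centralBinom] at h
    rwa [Nat.mul_div_cancel_left _ two_pos, pow_mul]
  · have h := centralBinom_sq_mul_le (n + 1)
    have hodd : (n + 1).centralBinom = 2 * (2 * n + 1).choose n := by
      rw [Nat.centralBinom, show 2 * (n + 1) = 2 * n + 1 + 1 by ring, Nat.choose_succ_succ,
        Nat.choose_symm_half]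
      ring
    have hhalf : (2 * n + 1) / 2 = n := by omega
    rw [hodd] at h
    rw [hhalf]
    have hscaled : 4 * ((2 * n + 1).choose n ^ 2 * (2 * n + 1 + 1)) ≤ 4 * 4 ^ (2 * n + 1) := by
      calc _ ≤ (2 * (2 * n + 1).choose n) ^ 2 * (2 * (n + 1) + 1) := by
            rw [mul_pow]; nlinarith [Nat.zero_le ((2 * n + 1).choose n ^ 2)]
        _ ≤ 16 ^ (n + 1) := h
        _ = _ := by
          rw [show (16 : ℕ) = 4 ^ 2 by norm_num, ← pow_mul]; ring
    omega

theorem choose_half_le {ε : ℝ} (hε : 0 < ε) (i : ℕ) :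
    (i.choose (i / 2) : ℝ) ≤ 2 ^ i * (ε / 2 + (2 * ε)⁻¹ * (i + 1 : ℝ)⁻¹) := by
  have hsq : (i.choose (i / 2) : ℝ) ^ 2 * (i + 1) ≤ (2 ^ i) ^ 2 := by
    rw [← pow_mul, mul_comm i 2, pow_mul, show (2 : ℝ) ^ 2 = 4 by norm_num]
    exact_mod_cast choose_half_sq_mul_le i
  set c : ℝ := (i.choose (i / 2) : ℝ)
  have hi : (0 : ℝ) < i + 1 := by positivity
  have hT : (0 : ℝ) < 2 ^ i := by positivity
  generalize (2 : ℝ) ^ i = T at hsq hT ⊢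
  -- AM-GM: `2 ε T c ≤ c² + ε² T²`
  have hamgm : c * (2 * ε * (i + 1)) ≤ T * (ε ^ 2 * (i + 1) + 1) := by
    refine le_of_mul_le_mul_left ?_ hT
    nlinarith [mul_nonneg hi.le (sq_nonneg (c - ε * T))]
  rw [← le_div_iff₀ (by positivity)] at hamgm
  refine hamgm.trans_eq ?_
  field_simp

theorem sum_binomial {x y : ℝ} (h : y + x = 1) (m : ℕ) :
    ∑ i ∈ Finset.range (m + 1), (m.choose i : ℝ) * x ^ i * y ^ (m - i) = 1 := by
  calc _ = (x + y) ^ m := by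
        rw [add_pow]
        exact Finset.sum_congr rfl fun i _ => by ring
    _ = 1 := by rw [add_comm, h, one_pow]

theorem sum_binomial_inv_le {x y : ℝ} (hx : 0 < x) (hy : 0 ≤ y) (h : y + x = 1) (m : ℕ) :
    ∑ i ∈ Finset.range (m + 1), (m.choose i : ℝ) * x ^ i * y ^ (m - i) * (i + 1 : ℝ)⁻¹ ≤
      (x * (m + 1))⁻¹ := by
  have habsorb : ∀ i ∈ Finset.range (m + 1),
      (m.choose i : ℝ) * x ^ i * y ^ (m - i) * (i + 1 : ℝ)⁻¹ =
        (x * (m + 1))⁻¹ *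
          (((m + 1).choose (i + 1) : ℝ) * x ^ (i + 1) * y ^ (m + 1 - (i + 1))) := by
    intro i _
    have hchoose : ((m : ℝ) + 1) * m.choose i = (m + 1).choose (i + 1) * (i + 1) := by
      exact_mod_cast Nat.add_one_mul_choose_eq m i
    rw [Nat.add_sub_add_right]
    field_simp
    linear_combination (x ^ (i + 1) * y ^ (m - i)) * hchoose
  have htotal := sum_binomial h (m + 1)
  rw [Finset.sum_range_succ'] at htotal
  rw [Finset.sum_congr rfl habsorb, ← Finset.mul_sum]
  refine mul_le_of_le_one_right (by positivity) (htotal ▸ le_add_of_nonneg_right ?_)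
  positivity

theorem sum_binomial_choose_half_le {x y k : ℝ} (hx : 0 < x) (hy : 0 ≤ y) (h : y + 2 * x = 1)
    (hk : 0 < k) {m : ℕ} (hm : 2 * k ^ 2 ≤ x * (m + 1)) :
    ∑ i ∈ Finset.range (m + 1),
      (m.choose i : ℝ) * x ^ i * y ^ (m - i) * (i.choose (i / 2) : ℝ) ≤ (2 * k)⁻¹ := by
  have hinv := sum_binomial_inv_le (x := 2 * x) (by positivity) hy h m
  calc _ ≤ ∑ i ∈ Finset.range (m + 1),
        ((4 * k)⁻¹ * ((m.choose i : ℝ) * (2 * x) ^ i * y ^ (m - i)) +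
        k * ((m.choose i : ℝ) * (2 * x) ^ i * y ^ (m - i) * (i + 1 : ℝ)⁻¹)) := by
        refine Finset.sum_le_sum fun i _ => ?_
        calc _ ≤ (m.choose i : ℝ) * x ^ i * y ^ (m - i) *
              (2 ^ i * ((2 * k)⁻¹ / 2 + (2 * (2 * k)⁻¹)⁻¹ * (i + 1 : ℝ)⁻¹)) := by
              gcongr
              exact choose_half_le (by positivity) i
          _ = _ := by rw [mul_pow]; field_simp; ring
    _ ≤ (4 * k)⁻¹ + k * (2 * x * (m + 1))⁻¹ := by
        rw [Finset.sum_add_distrib, ← Finset.mul_sum, ← Finset.mul_sum, sum_binomial h, mul_one]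
        gcongr
    _ ≤ (4 * k)⁻¹ + k * (2 * (2 * k ^ 2))⁻¹ := by
        rw [mul_assoc 2 x]
        gcongr
    _ = (2 * k)⁻¹ := by field_simp; norm_num

end Binomial

/-! ### Spreading of a random walk on a torsion-free group -/

section Expect

variable {α : Type*} {ρ : α → ℝ≥0∞}

theorem expect_mono {j : ℕ} {F F' : List α → ℝ≥0∞} (h : ∀ l, l.length = j → F l ≤ F' l) :
    expect ρ j F ≤ expect ρ j F' := by
  induction j generalizing F F' with
  | zero => exact h [] rfl
  | succ j ih =>
    refine ENNReal.tsum_le_tsum fun y => ?_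
    gcongr
    exact ih fun l hl => h _ (by simp [hl])

theorem expect_const_mul (c : ℝ≥0∞) (j : ℕ) (F : List α → ℝ≥0∞) :
    expect ρ j (fun l => c * F l) = c * expect ρ j F := by
  induction j generalizing F with
  | zero => rfl
  | succ j ih =>
    simp only [expect, ih, ← ENNReal.tsum_mul_left]
    exact tsum_congr fun y => by ring

theorem expect_add (j : ℕ) (F F' : List α → ℝ≥0∞) :
    expect ρ j (fun l => F l + F' l) = expect ρ j F + expect ρ j F' := by
  induction j generalizing F F' with
  | zero => rfl
  | succ j ih => simp only [expect, ih, mul_add, ENNReal.tsum_add]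

theorem expect_one (j : ℕ) : expect ρ j (fun _ => 1) = (∑' y, ρ y) ^ j := by
  induction j with
  | zero => simp [expect]
  | succ j ih => rw [expect, ih, ENNReal.tsum_mul_right, pow_succ']

theorem expect_append (a b : ℕ) (F : List α → ℝ≥0∞) :
    expect ρ (a + b) F = expect ρ a fun l => expect ρ b fun l' => F (l ++ l') := by
  induction a generalizing F with
  | zero => simp [expect]
  | succ a ih => rw [Nat.succ_add, expect, expect]; simp [ih]

theorem pathProb_mul_le_expect (l : List α) (F : List α → ℝ≥0∞) :
    pathProb ρ l * F l ≤ expect ρ l.length F := by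
  induction l generalizing F with
  | nil => simp [expect]
  | cons a l ih =>
    rw [List.length_cons, expect, pathProb_cons, mul_assoc]
    refine le_trans ?_ (ENNReal.le_tsum a)
    gcongr
    exact ih fun l => F (a :: l)

theorem expect_le_of_le (hρ : ∑' y, ρ y ≤ 1) {j : ℕ} {c : ℝ≥0∞} {F : List α → ℝ≥0∞}
    (h : ∀ l, l.length = j → F l ≤ c) : expect ρ j F ≤ c := by
  calc expect ρ j F ≤ expect ρ j fun _ => c * 1 := expect_mono fun l hl => by simpa using h l hl
    _ ≤ c := by
      rw [expect_const_mul, expect_one]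
      exact mul_le_of_le_one_right' (pow_le_one₀ bot_le hρ)

theorem expect_ite_add_expect_ite_not (P : List α → Prop) [DecidablePred P] (j : ℕ) :
    (expect ρ j fun l => if P l then 1 else 0) + (expect ρ j fun l => if ¬P l then 1 else 0) =
      (∑' y, ρ y) ^ j := by
  rw [← expect_add, ← expect_one]
  congr 1
  funext l
  split_ifs <;> simp_all

end Expect

section Transition

variable {E : Type*} [AddCommMonoid E] {ρ : E → ℝ≥0∞}

/-- The transition operator of the random walk with step distribution `ρ`, as a linear
endomorphism, so that its powers are those of the algebra of endomorphisms. -/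
def transition (ρ : E → ℝ≥0∞) : Module.End ℝ≥0∞ (E → ℝ≥0∞) where
  toFun f x := ∑' y, ρ y * f (x + y)
  map_add' f g := by
    funext x
    simp only [Pi.add_apply, mul_add, ENNReal.tsum_add]
  map_smul' c f := by
    funext x
    simp only [Pi.smul_apply, smul_eq_mul, RingHom.id_apply, ← ENNReal.tsum_mul_left]
    exact tsum_congr fun y => by ring

/-- The translation operator by `v`: the transition operator of a deterministic step `v`. -/
def translate (v : E) : Module.End ℝ≥0∞ (E → ℝ≥0∞) where
  toFun f x := f (x + v)
  map_add' _ _ := rfl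
  map_smul' _ _ := rfl

theorem transition_apply (f : E → ℝ≥0∞) (x : E) : transition ρ f x = ∑' y, ρ y * f (x + y) :=
  rfl

theorem translate_apply (v : E) (f : E → ℝ≥0∞) (x : E) : translate v f x = f (x + v) :=
  rfl

theorem translate_pow_apply (v : E) (k : ℕ) (f : E → ℝ≥0∞) (x : E) :
    (translate v ^ k) f x = f (x + k • v) := by
  induction k generalizing f with
  | zero => simp
  | succ k ih => rw [pow_succ, Module.End.mul_apply, ih, translate_apply, add_assoc, succ_nsmul]

theorem commute_translate (v w : E) : Commute (translate v) (translate w) := by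
  refine LinearMap.ext fun f => funext fun x => ?_
  simp only [Module.End.mul_apply, translate_apply, add_right_comm]

theorem commute_transition_translate (v : E) : Commute (transition ρ) (translate v) := by
  refine LinearMap.ext fun f => funext fun x => ?_
  simp only [Module.End.mul_apply, transition_apply, translate_apply, add_right_comm]

theorem expect_apply_add_sum (j : ℕ) (f : E → ℝ≥0∞) (x : E) :
    expect ρ j (fun l => f (x + l.sum)) = (transition ρ ^ j) f x := by
  induction j generalizing x with
  | zero => simp [expect]
  | succ j ih =>
    rw [expect, pow_succ', Module.End.mul_apply, transition_apply]
    refine tsum_congr fun y => ?_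
    simp only [← ih (x + y), List.sum_cons, add_assoc]

theorem transition_pow_le {c : ℝ≥0∞} {f : E → ℝ≥0∞} (hf : ∀ x, f x ≤ c) (j : ℕ) (x : E) :
    (transition ρ ^ j) f x ≤ (∑' y, ρ y) ^ j * c := by
  rw [← expect_apply_add_sum, ← expect_one, mul_comm, ← expect_const_mul]
  exact expect_mono fun l _ => by simpa using hf _

theorem exists_transition_eq_add {v w : E} (hvw : v ≠ w) {δ : ℝ≥0∞} (hv : δ ≤ ρ v)
    (hw : δ ≤ ρ w) : ∃ r : E → ℝ≥0∞, ∑' y, r y + 2 * δ = ∑' y, ρ y ∧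
      transition ρ = δ • (translate v + translate w) + transition r := by
  classical
  set e : E → ℝ≥0∞ := fun y => (if y = v then δ else 0) + if y = w then δ else 0 with he
  have hsplit : ∀ y, ρ y = (ρ y - e y) + e y := by
    intro y
    refine (tsub_add_cancel_of_le ?_).symm
    rcases eq_or_ne y v with rfl | hyv
    · simpa [e, hvw] using hv
    rcases eq_or_ne y w with rfl | hyw
    · simpa [e, hyv] using hw
    · simp [e, hyv, hyw]
  refine ⟨fun y => ρ y - e y, ?_, LinearMap.ext fun f => funext fun x => ?_⟩
  · simp only [tsum_congr hsplit, ENNReal.tsum_add]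
    simp only [he, ENNReal.tsum_add, tsum_ite_eq, two_mul]
  · rw [LinearMap.add_apply, Pi.add_apply, transition_apply, transition_apply, add_comm,
      tsum_congr fun y => congrArg (· * f (x + y)) (hsplit y)]
    simp only [add_mul, ENNReal.tsum_add]
    simp [he, add_mul, ENNReal.tsum_add, translate_apply]

end Transition

section Spreading

variable {E : Type*} [AddCommGroup E] [IsAddTorsionFree E] {ρ : E → ℝ≥0∞} {v w : E}

theorem injOn_nsmul_add_nsmul_sub (hvw : v ≠ w) (x : E) (i : ℕ) :
    Set.InjOn (fun k => x + k • v + (i - k) • w) (Set.Iic i) := by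
  have hinj : Function.Injective fun k : ℕ => k • (v - w) :=
    injective_nsmul_iff_not_isOfFinAddOrder.2
      (not_isOfFinAddOrder_of_isAddTorsionFree (sub_ne_zero.2 hvw))
  have hform : ∀ k ∈ Set.Iic i, x + k • v + (i - k) • w = k • (v - w) + (x + i • w) := by
    intro k hk
    obtain ⟨c, rfl⟩ := Nat.exists_eq_add_of_le (Set.mem_Iic.1 hk)
    rw [Nat.add_sub_cancel_left, smul_sub, add_nsmul]
    abel
  intro k hk k' hk' h
  exact hinj (add_right_cancel ((hform k hk).symm.trans (h.trans (hform k' hk'))))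

variable [DecidableEq E]

theorem translate_add_pow_indicator_le (hvw : v ≠ w) (A : Finset E) (i : ℕ) (x : E) :
    ((translate v + translate w) ^ i) (fun y => if y ∈ A then 1 else 0) x ≤
      (i.choose (i / 2) : ℝ≥0∞) * A.card := by
  have hterm : ∀ k ∈ Finset.range (i + 1),
      (translate v ^ k * translate w ^ (i - k) * (i.choose k : Module.End ℝ≥0∞ (E → ℝ≥0∞)))
        (fun y => if y ∈ A then 1 else 0) x ≤
      (i.choose (i / 2) : ℝ≥0∞) * if x + k • v + (i - k) • w ∈ A then 1 else 0 := by
    intro k _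
    rw [← Nat.cast_comm, ← nsmul_eq_mul, LinearMap.smul_apply, Pi.smul_apply,
      Module.End.mul_apply, translate_pow_apply, translate_pow_apply, nsmul_eq_mul]
    gcongr
    exact Nat.choose_le_middle k i
  rw [(commute_translate v w).add_pow, LinearMap.sum_apply, Finset.sum_apply]
  refine (Finset.sum_le_sum hterm).trans ?_
  rw [← Finset.mul_sum, Finset.sum_boole]
  gcongr
  refine Finset.card_le_card_of_injOn (fun k => x + k • v + (i - k) • w)
    (fun k hk => (Finset.mem_filter.1 hk).2) ((injOn_nsmul_add_nsmul_sub hvw x i).mono ?_)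
  intro k hk
  exact Nat.lt_succ_iff.1 (Finset.mem_range.1 (Finset.mem_filter.1 hk).1)

theorem exists_transition_pow_indicator_le (hvw : v ≠ w) {δ : ℝ≥0∞} (hv : δ ≤ ρ v)
    (hw : δ ≤ ρ w) : ∃ r : ℝ≥0∞, r + 2 * δ = ∑' y, ρ y ∧ ∀ (m : ℕ) (A : Finset E) (x : E),
      (transition ρ ^ m) (fun y => if y ∈ A then 1 else 0) x ≤
        (∑ i ∈ Finset.range (m + 1),
          (m.choose i : ℝ≥0∞) * δ ^ i * r ^ (m - i) * (i.choose (i / 2) : ℝ≥0∞)) * A.card := by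
  obtain ⟨r, hr, hsplit⟩ := exists_transition_eq_add hvw hv hw
  refine ⟨_, hr, fun m A x => ?_⟩
  have hcomm : Commute (δ • (translate v + translate w)) (transition r) :=
    (((commute_transition_translate v).add_right (commute_transition_translate w)).smul_right
      δ).symm
  rw [hsplit, hcomm.add_pow, LinearMap.sum_apply, Finset.sum_apply, Finset.sum_mul]
  refine Finset.sum_le_sum fun i _ => ?_
  have hterm : (δ • (translate v + translate w)) ^ i * transition r ^ (m - i) *
      (m.choose i : Module.End ℝ≥0∞ (E → ℝ≥0∞)) =
      m.choose i • δ ^ i • (transition r ^ (m - i) * (translate v + translate w) ^ i) := by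
    rw [← Nat.cast_comm, (hcomm.pow_pow i (m - i)).eq, ← nsmul_eq_mul, smul_pow, mul_smul_comm]
  rw [hterm, LinearMap.smul_apply, Pi.smul_apply, LinearMap.smul_apply, Pi.smul_apply,
    Module.End.mul_apply, nsmul_eq_mul, smul_eq_mul, mul_assoc, mul_assoc, mul_assoc]
  gcongr
  exact transition_pow_le (translate_add_pow_indicator_le hvw A i) _ _

theorem exists_expect_indicator_le_half (hρ : ∑' y, ρ y = 1) (hvw : v ≠ w) (hv : ρ v ≠ 0)
    (hw : ρ w ≠ 0) :
    ∃ C : ℕ, ∀ (K : ℕ) (A : Finset E) (x : E), A.card ≤ K →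
      expect ρ (C * (K + 1) ^ 2) (fun l => if x + l.sum ∈ A then 1 else 0) ≤ 2⁻¹ := by
  obtain ⟨r, hr, hle⟩ := exists_transition_pow_indicator_le hvw (min_le_left (ρ v) (ρ w))
    (min_le_right _ _)
  have hδ : min (ρ v) (ρ w) ≠ 0 := (lt_min hv.bot_lt hw.bot_lt).ne'
  generalize min (ρ v) (ρ w) = δ at hr hle hδ
  rw [hρ] at hr
  lift r to NNReal using by rintro rfl; simp at hr
  lift δ to NNReal using by rintro rfl; simp at hr
  have hδ' : (0 : ℝ) < δ := by exact_mod_cast pos_iff_ne_zero.2 hδ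
  obtain ⟨C, hC⟩ := exists_nat_ge (2 / (δ : ℝ))
  rw [div_le_iff₀ hδ'] at hC
  refine ⟨C, fun K A x hA => ?_⟩
  rw [expect_apply_add_sum _ fun y => if y ∈ A then 1 else 0]
  refine (hle _ A x).trans ?_
  have hm : 2 * (K + 1 : ℝ) ^ 2 ≤ δ * ((C * (K + 1) ^ 2 : ℕ) + 1) := by
    push_cast
    nlinarith [sq_nonneg (K + 1 : ℝ)]
  generalize C * (K + 1) ^ 2 = m at hm ⊢
  have hsum := sum_binomial_choose_half_le hδ' r.coe_nonneg (by exact_mod_cast hr)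
    (by positivity) hm
  have hA' : (A.card : ℝ) ≤ K + 1 := by exact_mod_cast hA.trans K.le_succ
  have hprod := mul_le_mul hsum hA' (Nat.cast_nonneg _) (by positivity)
  rw [mul_inv, inv_mul_cancel_right₀ (by positivity)] at hprod
  have hnn : (∑ i ∈ Finset.range (m + 1), (m.choose i : NNReal) * δ ^ i * r ^ (m - i) *
      (i.choose (i / 2) : NNReal)) * A.card ≤ 2⁻¹ := by
    exact_mod_cast hprod
  have henn := ENNReal.coe_le_coe.2 hnn
  push_cast at henn
  exact henn

end Spreading

/-! ### Frequently visited sites -/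

section Mixture

theorem mul_add_le_mul_add_one_sub {a b κ θ : ℝ≥0∞} (hab : a + b = 1) (hκ : κ ≤ a) (hθ : θ ≤ 1) :
    θ * a + b ≤ θ * κ + (1 - κ) := by
  obtain ⟨c, rfl⟩ := exists_add_of_le hκ
  have hκt : κ ≠ ⊤ := by
    rintro rfl
    simp at hab
  have hc : c + b = 1 - κ := by
    rw [← hab, add_assoc, ENNReal.add_sub_cancel_left hκt]
  rw [mul_add, add_assoc, ← hc]
  gcongr
  exact mul_le_of_le_one_left' hθ

theorem mul_add_one_sub_lt_one {κ θ : ℝ≥0∞} (hκ : κ ≠ 0) (hκ1 : κ ≤ 1) (hθ : θ < 1) :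
    θ * κ + (1 - κ) < 1 := by
  have hκt : κ ≠ ⊤ := ne_top_of_le_ne_top ENNReal.one_ne_top hκ1
  calc θ * κ + (1 - κ) < 1 * κ + (1 - κ) :=
        ENNReal.add_lt_add_right (by simp) ((ENNReal.mul_lt_mul_iff_left hκ hκt).2 hθ)
    _ = 1 := by rw [one_mul, add_tsub_cancel_of_le hκ1]

theorem expect_ite_le {α : Type*} {ρ : α → ℝ≥0∞} (hρ : ∑' y, ρ y = 1) {j : ℕ}
    {P : List α → Prop} [DecidablePred P] {κ θ : ℝ≥0∞}
    (hκ : κ ≤ expect ρ j fun l => if P l then 1 else 0) (hθ : θ ≤ 1) :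
    (expect ρ j fun l => if P l then θ else 1) ≤ θ * κ + (1 - κ) := by
  have hsplit : (expect ρ j fun l => if P l then θ else 1) =
      θ * (expect ρ j fun l => if P l then 1 else 0) +
        expect ρ j fun l => if ¬P l then 1 else 0 := by
    rw [← expect_const_mul, ← expect_add]
    congr 1
    funext l
    split_ifs <;> simp_all
  rw [hsplit]
  refine mul_add_le_mul_add_one_sub ?_ hκ hθ
  rw [expect_ite_add_expect_ite_not, hρ, one_pow]

end Mixture

section Frequent

variable {α : Type*} [DecidableEq α] {G : ℕ → ℝ≥0∞}

/-- The sites occurring more than `h` times in `M`. Each of them costs a factor at most `G (h + 1)`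
in `allowProb G M`, so a walk with many frequent sites is unlikely to be allowed. -/
def frequent (h : ℕ) (M : List α) : Finset α :=
  M.toFinset.filter fun x => h + 1 ≤ M.count x

theorem mem_frequent {h : ℕ} {M : List α} {x : α} : x ∈ frequent h M ↔ h + 1 ≤ M.count x := by
  rw [frequent, Finset.mem_filter, List.mem_toFinset, and_iff_right_iff_imp]
  intro hx
  exact List.count_pos_iff.1 (by omega)

theorem frequent_subset_append (h : ℕ) (M M' : List α) : frequent h M ⊆ frequent h (M ++ M') := by
  intro x hx
  rw [mem_frequent] at hx ⊢
  rw [List.count_append]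
  omega

theorem allowProb_le_pow_card_frequent (h0 : G 0 = 1) (hG : Antitone G) (h : ℕ) (M : List α) :
    allowProb G M ≤ G (h + 1) ^ (frequent h M).card := by
  rw [frequent, ← Finset.prod_const, Finset.prod_filter]
  refine Finset.prod_le_prod' fun x _ => ?_
  split_ifs with hx
  · exact hG hx
  · exact (hG (Nat.zero_le _)).trans h0.le

end Frequent

section Loops

variable {α : Type*} {p : α → ℝ≥0∞}

/-- The path that runs through the steps `O` exactly `k` times; with `O` a loop it makes a site
frequent. -/
def loops (O : List α) (k : ℕ) : List α := (List.replicate k O).flatten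

theorem loops_succ (O : List α) (k : ℕ) : loops O (k + 1) = O ++ loops O k := by
  simp [loops, List.replicate_succ]

theorem pathProb_loops (O : List α) (k : ℕ) : pathProb p (loops O k) = pathProb p O ^ k := by
  induction k with
  | zero => simp [loops]
  | succ k ih => rw [loops_succ, pathProb_append, ih, pow_succ']

theorem pathProb_le_one (hp : ∑' y, p y ≤ 1) (l : List α) : pathProb p l ≤ 1 := by
  have h := pathProb_mul_le_expect (ρ := p) l fun _ => 1
  rw [mul_one] at h
  exact h.trans (expect_le_of_le hp fun _ _ => le_rfl)

theorem le_count_sites_loops {E : Type*} [AddCommGroup E] [DecidableEq E] {O : List E}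
    (hO : O ≠ []) (hs : O.sum = 0) (k : ℕ) (z : E) : k ≤ (sites z (loops O k)).count z := by
  induction k with
  | zero => simp
  | succ k ih =>
    have hfirst : 0 < (sites z O).count z :=
      List.count_pos_iff.2 (by simpa using add_sum_mem_sites_append (s := z) (l := []) hO)
    rw [loops_succ, sites_append, List.count_append, hs, add_zero]
    omega

end Loops

section FrequentGen

variable {E : Type*} [AddCommGroup E] [DecidableEq E] {ρ : E → ℝ≥0∞} {O : List E} {θ : ℝ≥0∞}

theorem pow_card_frequent_append_le (hθ : θ ≤ 1) (h : ℕ) (s : E) (l l' : List E) :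
    θ ^ (frequent h (sites s (l ++ l'))).card ≤ θ ^ (frequent h (sites s l)).card := by
  rw [sites_append]
  exact pow_le_pow_right_of_le_one' hθ (Finset.card_le_card (frequent_subset_append h _ _))

theorem card_frequent_lt_of_loops (hO : O ≠ []) (hs : O.sum = 0) {h : ℕ} {s : E} {l l' : List E}
    (hl : s + (l ++ l').sum ∉ frequent h (sites s l)) :
    (frequent h (sites s l)).card <
      (frequent h (sites s ((l ++ l') ++ loops O (h + 1)))).card := by
  refine Finset.card_lt_card (Finset.ssubset_iff.2 ⟨_, hl, Finset.insert_subset ?_ ?_⟩)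
  · rw [mem_frequent, sites_append, List.count_append]
    exact (le_count_sites_loops hO hs (h + 1) _).trans (Nat.le_add_left _ _)
  · rw [List.append_assoc, sites_append]
    exact frequent_subset_append h _ _

theorem expect_pow_card_frequent_loops_le (hρ : ∑' y, ρ y = 1) (hO : O ≠ []) (hs : O.sum = 0)
    (hθ : θ ≤ 1) {h : ℕ} {s : E} {l l' : List E} (hl : s + (l ++ l').sum ∉ frequent h (sites s l)) :
    expect ρ (loops O (h + 1)).length
        (fun l'' => θ ^ (frequent h (sites s ((l ++ l') ++ l''))).card) ≤
      θ ^ (frequent h (sites s l)).card *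
        (θ * pathProb ρ (loops O (h + 1)) + (1 - pathProb ρ (loops O (h + 1)))) := by
  set Q := loops O (h + 1)
  have hpoint : ∀ l'', θ ^ (frequent h (sites s ((l ++ l') ++ l''))).card ≤
      θ ^ (frequent h (sites s l)).card * if l'' = Q then θ else 1 := by
    intro l''
    split_ifs with hQ
    · subst hQ
      rw [← pow_succ]
      exact pow_le_pow_right_of_le_one' hθ (card_frequent_lt_of_loops hO hs hl)
    · rw [mul_one, List.append_assoc]
      exact pow_card_frequent_append_le hθ h s l _
  refine (expect_mono fun l'' _ => hpoint l'').trans ?_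
  rw [expect_const_mul]
  gcongr
  refine expect_ite_le hρ ?_ hθ
  simpa using pathProb_mul_le_expect (ρ := ρ) Q fun l => if l = Q then 1 else 0

theorem half_le_expect_notMem (hρ : ∑' y, ρ y = 1) {m : ℕ} {A : Finset E} {x : E}
    (h : expect ρ m (fun l => if x + l.sum ∈ A then 1 else 0) ≤ 2⁻¹) :
    2⁻¹ ≤ expect ρ m fun l => if x + l.sum ∉ A then 1 else 0 := by
  have hsum := expect_ite_add_expect_ite_not (ρ := ρ) (fun l => x + l.sum ∈ A) m
  rw [hρ, one_pow] at hsum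
  by_contra! hlt
  have hlt' := ENNReal.add_lt_add_of_le_of_lt (ne_top_of_le_ne_top (by simp) h) h hlt
  rw [hsum, ENNReal.inv_two_add_inv_two] at hlt'
  exact hlt'.false

/-- In the first `m` steps the walk leaves the set of frequent sites with probability at least
`1 / 2`, and the loops it may then run through create a new one. -/
theorem expect_pow_card_frequent_window_le (hρ : ∑' y, ρ y = 1) (hO : O ≠ []) (hs : O.sum = 0)
    (h : ℕ) (hθ : θ ≤ 1) (s : E) (l : List E) (m : ℕ)
    (hm : expect ρ m (fun l' => if s + l.sum + l'.sum ∈ frequent h (sites s l) then 1 else 0) ≤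
      2⁻¹) :
    expect ρ (m + (loops O (h + 1)).length)
        (fun l' => θ ^ (frequent h (sites s (l ++ l'))).card) ≤
      θ ^ (frequent h (sites s l)).card *
        ((θ * pathProb ρ (loops O (h + 1)) + (1 - pathProb ρ (loops O (h + 1)))) * 2⁻¹ +
          (1 - 2⁻¹)) := by
  set Q := loops O (h + 1)
  have hQ : pathProb ρ Q ≤ 1 := pathProb_le_one hρ.le Q
  have hθ₁ : θ * pathProb ρ Q + (1 - pathProb ρ Q) ≤ 1 := by
    calc _ ≤ 1 * pathProb ρ Q + (1 - pathProb ρ Q) := by gcongr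
      _ = 1 := by rw [one_mul, add_tsub_cancel_of_le hQ]
  have hpoint : ∀ l', expect ρ Q.length
      (fun l'' => θ ^ (frequent h (sites s (l ++ (l' ++ l'')))).card) ≤
        θ ^ (frequent h (sites s l)).card * if s + l.sum + l'.sum ∉ frequent h (sites s l)
          then θ * pathProb ρ Q + (1 - pathProb ρ Q) else 1 := by
    intro l'
    split_ifs with hl
    · rw [mul_one]
      exact expect_le_of_le hρ.le fun l'' _ => pow_card_frequent_append_le hθ h s l _
    · simp only [← List.append_assoc]
      rw [add_assoc, ← List.sum_append] at hl
      exact expect_pow_card_frequent_loops_le hρ hO hs hθ hl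
  rw [expect_append]
  refine (expect_mono fun l' _ => hpoint l').trans ?_
  rw [expect_const_mul]
  gcongr
  exact expect_ite_le hρ (half_le_expect_notMem hρ hm) hθ₁

/-- The generating function of the number of frequent sites after `j` steps. -/
def frequentGen (ρ : E → ℝ≥0∞) (h : ℕ) (θ : ℝ≥0∞) (j : ℕ) : ℝ≥0∞ :=
  expect ρ j fun l => θ ^ (frequent h (sites 0 l)).card

theorem frequentGen_le_one (hρ : ∑' y, ρ y ≤ 1) (h : ℕ) (hθ : θ ≤ 1) (j : ℕ) :
    frequentGen ρ h θ j ≤ 1 :=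
  expect_le_of_le hρ fun _ _ => pow_le_one₀ bot_le hθ

theorem frequentGen_antitone (hρ : ∑' y, ρ y ≤ 1) (h : ℕ) (hθ : θ ≤ 1) :
    Antitone (frequentGen ρ h θ) := by
  refine antitone_nat_of_succ_le fun j => ?_
  rw [frequentGen, expect_append]
  exact expect_mono fun l _ => expect_le_of_le hρ fun l' _ =>
    pow_card_frequent_append_le hθ h 0 l l'

variable [IsAddTorsionFree E] {v w : E}

theorem exists_frequentGen_add_le (hρ : ∑' y, ρ y = 1) (hO : O ≠ []) (hs : O.sum = 0)
    (hp : pathProb ρ O ≠ 0) (hvw : v ≠ w) (hv : ρ v ≠ 0) (hw : ρ w ≠ 0) (h : ℕ) (hθ : θ < 1) :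
    ∃ θ' : ℝ≥0∞, θ' < 1 ∧ ∃ C B : ℕ, 1 ≤ B ∧ ∀ K j : ℕ,
      frequentGen ρ h θ (j + (C * (K + 1) ^ 2 + B)) ≤
        θ' * frequentGen ρ h θ j + θ ^ (K + 1) := by
  obtain ⟨C, hC⟩ := exists_expect_indicator_le_half hρ hvw hv hw
  have hQ : pathProb ρ (loops O (h + 1)) ≤ 1 := pathProb_le_one hρ.le _
  have hQ0 : pathProb ρ (loops O (h + 1)) ≠ 0 := by
    rw [pathProb_loops]
    exact pow_ne_zero _ hp
  refine ⟨_, mul_add_one_sub_lt_one (κ := 2⁻¹) (by simp) (by simp)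
    (mul_add_one_sub_lt_one hQ0 hQ hθ), C, (loops O (h + 1)).length, ?_, fun K j => ?_⟩
  · rw [loops_succ, List.length_append]
    exact (List.length_pos_iff.2 hO).trans_le le_self_add
  set θ' := (θ * pathProb ρ (loops O (h + 1)) + (1 - pathProb ρ (loops O (h + 1)))) * 2⁻¹ +
    (1 - 2⁻¹)
  have hpoint : ∀ l : List E, expect ρ (C * (K + 1) ^ 2 + (loops O (h + 1)).length)
      (fun l' => θ ^ (frequent h (sites 0 (l ++ l'))).card) ≤
        θ' * θ ^ (frequent h (sites 0 l)).card + θ ^ (K + 1) * 1 := by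
    intro l
    rcases le_or_gt (frequent h (sites 0 l)).card K with hK | hK
    · rw [mul_comm θ']
      exact (expect_pow_card_frequent_window_le hρ hO hs h hθ.le 0 l _ (hC K _ _ hK)).trans
        le_self_add
    · rw [mul_one]
      exact le_add_left (expect_le_of_le hρ.le fun l' _ =>
        (pow_card_frequent_append_le hθ.le h 0 l l').trans (pow_le_pow_right_of_le_one' hθ.le hK))
  rw [frequentGen, frequentGen, expect_append, ← expect_const_mul]
  refine (expect_mono fun l _ => hpoint l).trans_eq ?_
  rw [expect_add, expect_const_mul (θ ^ (K + 1)), expect_one, hρ, one_pow, mul_one]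

theorem tsum_pow_mul_geometric_ne_top (k : ℕ) {r : ℝ≥0∞} (hr : r < 1) :
    ∑' n : ℕ, (n : ℝ≥0∞) ^ k * r ^ n ≠ ⊤ := by
  lift r to NNReal using hr.ne_top
  have hsum : Summable fun n : ℕ => (n : ℝ) ^ k * (r : ℝ) ^ n :=
    summable_pow_mul_geometric_of_norm_lt_one k (by simpa using hr)
  have hnn : Summable fun n : ℕ => (n : NNReal) ^ k * r ^ n := by exact_mod_cast hsum
  exact_mod_cast ENNReal.tsum_coe_ne_top_iff_summable.2 hnn

theorem apply_mul_le_of_add_le {b : ℕ → ℝ≥0∞} (hb : b 0 ≤ 1) {r c : ℝ≥0∞} (hr : r ≤ 1) {L : ℕ}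
    (hstep : ∀ j, b (j + L) ≤ r * b j + c) (i : ℕ) : b (i * L) ≤ r ^ i + i * c := by
  induction i with
  | zero => simpa using hb
  | succ i ih =>
    calc b ((i + 1) * L) ≤ r * b (i * L) + c := by
          rw [Nat.succ_mul]
          exact hstep _
      _ ≤ r * (r ^ i + i * c) + c := by gcongr
      _ ≤ r ^ (i + 1) + 1 * (i * c) + c := by
          rw [mul_add, pow_succ' r i]
          gcongr
      _ = _ := by push_cast; ring

/-- Geometric decay along a polynomially sparse sequence of times. -/
theorem tsum_ne_top_of_antitone_of_le {b : ℕ → ℝ≥0∞} (hb : Antitone b) (hb0 : b 0 ≤ 1)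
    {r : ℝ≥0∞} (hr : r < 1) {C B : ℕ} (hB : 1 ≤ B)
    (hle : ∀ K : ℕ, b ((K + 1) * (C * (K + 1) ^ 2 + B)) ≤ (K + 2 : ℕ) * r ^ (K + 1)) :
    ∑' j, b j ≠ ⊤ := by
  set J : ℕ → ℕ := fun K => (K + 1) * (C * (K + 1) ^ 2 + B)
  have hJmono : StrictMono J := fun K K' h => by
    have hfactor : C * (K + 1) ^ 2 + B ≤ C * (K' + 1) ^ 2 + B := by gcongr
    exact Nat.mul_lt_mul_of_lt_of_le (Nat.succ_lt_succ h) hfactor (by omega)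
  have hterm : ∀ K, ((J (K + 1) : ℝ≥0∞) - J K) * b (J K) ≤
      (16 * (C + B) : ℕ) * (((K + 1 : ℕ) : ℝ≥0∞) ^ 4 * r ^ (K + 1)) := by
    intro K
    have hpoly : J (K + 1) * (K + 2) ≤ 16 * (C + B) * (K + 1) ^ 4 := by
      calc (K + 1 + 1) * (C * (K + 1 + 1) ^ 2 + B) * (K + 2)
          ≤ (K + 2) * (C * (K + 2) ^ 2 + B * (K + 2) ^ 2) * (K + 2) := by
            gcongr
            exact Nat.le_mul_of_pos_right _ (by positivity)
        _ = (C + B) * (K + 2) ^ 4 := by ring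
        _ ≤ (C + B) * (2 * (K + 1)) ^ 4 := by gcongr; omega
        _ = _ := by ring
    calc ((J (K + 1) : ℝ≥0∞) - J K) * b (J K)
        ≤ J (K + 1) * ((K + 2 : ℕ) * r ^ (K + 1)) := by
          gcongr
          exacts [tsub_le_self, hle K]
      _ = (J (K + 1) * (K + 2) : ℕ) * r ^ (K + 1) := by push_cast; ring
      _ ≤ (16 * (C + B) * (K + 1) ^ 4 : ℕ) * r ^ (K + 1) := by gcongr
      _ = _ := by push_cast; ring
  refine ne_top_of_le_ne_top (ENNReal.add_ne_top.2 ⟨ENNReal.sum_ne_top.2 fun j _ => ?_, ?_⟩)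
    (ENNReal.le_tsum_schlomilch (fun _ _ _ h => hb h) (fun K => by positivity) hJmono)
  · exact ne_top_of_le_ne_top ENNReal.one_ne_top ((hb j.zero_le).trans hb0)
  · refine ne_top_of_le_ne_top ?_ (ENNReal.tsum_le_tsum hterm)
    rw [ENNReal.tsum_mul_left]
    exact ENNReal.mul_ne_top (ENNReal.natCast_ne_top _) (ne_top_of_le_ne_top
      (tsum_pow_mul_geometric_ne_top 4 hr)
      (ENNReal.tsum_comp_le_tsum_of_injective (add_left_injective 1) _))

theorem tsum_frequentGen_ne_top (hρ : ∑' y, ρ y = 1) (hO : O ≠ []) (hs : O.sum = 0)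
    (hp : pathProb ρ O ≠ 0) (hvw : v ≠ w) (hv : ρ v ≠ 0) (hw : ρ w ≠ 0) (h : ℕ) (hθ : θ < 1) :
    ∑' j, frequentGen ρ h θ j ≠ ⊤ := by
  obtain ⟨θ', hθ', C, B, hB, hstep⟩ := exists_frequentGen_add_le hρ hO hs hp hvw hv hw h hθ
  have hle1 := frequentGen_le_one hρ.le h hθ.le 0
  refine tsum_ne_top_of_antitone_of_le (frequentGen_antitone hρ.le h hθ.le) hle1
    (max_lt hθ' hθ) hB fun K => (apply_mul_le_of_add_le hle1 hθ'.le (hstep K) (K + 1)).trans ?_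
  calc θ' ^ (K + 1) + (K + 1 : ℕ) * θ ^ (K + 1)
      ≤ max θ' θ ^ (K + 1) + (K + 1 : ℕ) * max θ' θ ^ (K + 1) := by
        gcongr
        exacts [le_max_left _ _, le_max_right _ _]
    _ = _ := by push_cast; ring

end FrequentGen

section ConstrainedWalk

variable {E : Type*} [AddCommGroup E] {ρ : E → ℝ≥0∞} {G : ℕ → ℝ≥0∞}

theorem expect_of_apply_zero (hρ : ∀ y, y ≠ 0 → ρ y = 0) (h1 : ρ 0 = 1) (j : ℕ)
    (F : List E → ℝ≥0∞) : expect ρ j F = F (List.replicate j 0) := by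
  induction j generalizing F with
  | zero => rfl
  | succ j ih =>
    rw [expect, tsum_eq_single 0 fun y hy => by rw [hρ y hy, zero_mul], h1, one_mul, ih,
      List.replicate_succ]

theorem sites_replicate_zero (j : ℕ) :
    sites (0 : E) (List.replicate j 0) = List.replicate j 0 := by
  induction j with
  | zero => rfl
  | succ j ih => rw [List.replicate_succ, sites_cons, add_zero, ih]

theorem allowProb_replicate {α : Type*} [DecidableEq α] (h0 : G 0 = 1) (j : ℕ) (x : α) :
    allowProb G (List.replicate j x) = G j := by
  rw [allowProb_eq_prod h0 (T := {x}) (by simp [Finset.subset_iff])]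
  simp

variable [IsAddTorsionFree E]

theorem exists_mem_ne_of_sum_eq_zero {O : List E} (hO : O ≠ []) (hs : O.sum = 0) {v : E}
    (hv : v ≠ 0) : ∃ w ∈ O, w ≠ v := by
  by_contra! hall
  rw [List.sum_eq_card_nsmul O v hall] at hs
  have hlen : O.length ≠ 0 := List.length_eq_zero_iff.not.2 hO
  exact hv (nsmul_right_injective hlen (by simpa using hs))

variable [DecidableEq E]

/-- If the walk survives forever and has two possible steps, it produces many frequent sites; if
its only step is `0`, the constraint at one site must kill it. -/
theorem tsum_expect_allowProb_ne_top (h0 : G 0 = 1) (hG : Antitone G) (hρ : ∑' y, ρ y ≤ 1)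
    (hloop : ∑' y, ρ y = 1 → ∃ O : List E, O ≠ [] ∧ O.sum = 0 ∧ pathProb ρ O ≠ 0)
    (hfin : ∑' y, ρ y = 1 → ∃ h, G (h + 1) < 1)
    (hmean : ρ 0 = 1 → ∑' j, G j ≠ ⊤) :
    ∑' j, expect ρ j (fun l => allowProb G (sites 0 l)) ≠ ⊤ := by
  rcases hρ.lt_or_eq with hlt | heq
  · refine ne_top_of_le_ne_top (b := ∑' j, (∑' y, ρ y) ^ j) ?_ (ENNReal.tsum_le_tsum fun j => ?_)
    · rw [ENNReal.tsum_geometric]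
      exact ENNReal.inv_ne_top.2 (tsub_pos_of_lt hlt).ne'
    · rw [← expect_one]
      exact expect_mono fun l _ => allowProb_le_one h0 hG _
  by_cases hv : ∃ v, v ≠ 0 ∧ ρ v ≠ 0
  · obtain ⟨v, hv0, hv⟩ := hv
    obtain ⟨O, hO, hs, hp⟩ := hloop heq
    obtain ⟨h, hh⟩ := hfin heq
    obtain ⟨w, hwO, hwv⟩ := exists_mem_ne_of_sum_eq_zero hO hs hv0
    exact ne_top_of_le_ne_top (tsum_frequentGen_ne_top heq hO hs hp hwv.symm hv
      (apply_ne_zero_of_pathProb_ne_zero hp hwO) h hh) (ENNReal.tsum_le_tsum fun j =>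
        expect_mono fun l _ => allowProb_le_pow_card_frequent h0 hG h _)
  · push Not at hv
    have h1 : ρ 0 = 1 := by rw [← heq, tsum_eq_single 0 hv]
    simpa only [expect_of_apply_zero hv h1, sites_replicate_zero, allowProb_replicate h0]
      using hmean h1

end ConstrainedWalk

/-! ### Renewal sequences -/

section Renewal

open Filter Topology

/-- The probability `1 - (g 0 + ⋯ + g (i - 1))` that a lifetime exceeds `i`, when it equals `k + 1`
with probability `g k`. -/
def survival (g : ℕ → ℝ) (i : ℕ) : ℝ := 1 - ∑ k ∈ Finset.range i, g k

/-- The renewal equation: `a n` is the probability of a renewal at time `n` when the lifetimes have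
the law `g` on `k + 1`, and time `0` is a renewal. -/
structure IsRenewal (a g : ℕ → ℝ) : Prop where
  zero : a 0 = 1
  succ : ∀ n, a (n + 1) = ∑ k ∈ Finset.range (n + 1), g k * a (n - k)

variable {a g u f : ℕ → ℝ} {c C : ℝ}

theorem survival_zero : survival g 0 = 1 := by simp [survival]

theorem survival_succ (i : ℕ) : survival g (i + 1) = survival g i - g i := by
  rw [survival, survival, Finset.sum_range_succ, sub_add_eq_sub_sub]

theorem survival_antitone (hg : ∀ k, 0 ≤ g k) : Antitone (survival g) :=
  antitone_nat_of_succ_le fun i => by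
    rw [survival_succ]
    exact sub_le_self _ (hg i)

theorem sum_succ_mul_eq_sum_survival (n : ℕ) :
    ∑ k ∈ Finset.range n, ((k + 1 : ℕ) : ℝ) * g k =
      ∑ i ∈ Finset.range n, survival g i - n * survival g n := by
  induction n with
  | zero => simp
  | succ n ih =>
    rw [Finset.sum_range_succ, ih, Finset.sum_range_succ, survival_succ]
    push_cast
    ring

/-- The last renewal before time `n + 1` is at exactly one of the times `0, …, n`. -/
theorem IsRenewal.sum_mul_survival_eq_one (hren : IsRenewal a g) (n : ℕ) :
    ∑ i ∈ Finset.range (n + 1), a (n - i) * survival g i = 1 := by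
  induction n with
  | zero => simp [hren.zero, survival_zero]
  | succ n ih =>
    rw [Finset.sum_range_succ', Nat.sub_zero, survival_zero, mul_one, hren.succ n,
      ← Finset.sum_add_distrib, ← ih]
    refine Finset.sum_congr rfl fun i _ => ?_
    rw [Nat.add_sub_add_right, survival_succ]
    ring

theorem one_le_add_mul_survival (ha : ∀ n, c ≤ a n) (ha1 : ∀ n, a n ≤ 1) (hg : ∀ k, 0 ≤ g k)
    (hren : IsRenewal a g)
    (hc : 0 ≤ c) {i : ℕ} (hi : survival g i ≤ 0) (m : ℕ) :
    1 ≤ i + (m + 1 : ℕ) * (c * survival g i) := by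
  rw [← hren.sum_mul_survival_eq_one (i + m), add_assoc, Finset.sum_range_add]
  refine add_le_add ?_ ?_
  · calc _ ≤ ∑ _j ∈ Finset.range i, (1 : ℝ) := Finset.sum_le_sum fun j _ => by
          have hone : survival g j ≤ 1 := survival_zero.le.trans' (survival_antitone hg j.zero_le)
          exact (mul_le_mul_of_nonneg_left hone (hc.trans (ha _))).trans (by simpa using ha1 _)
      _ = i := by simp
  · calc _ ≤ ∑ _j ∈ Finset.range (m + 1), c * survival g i := Finset.sum_le_sum fun j _ =>
          (mul_le_mul_of_nonneg_left (survival_antitone hg (i.le_add_right j))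
            (hc.trans (ha _))).trans (mul_le_mul_of_nonpos_right (ha _) hi)
      _ = _ := by simp

theorem survival_nonneg (hc : 0 < c) (ha : ∀ n, c ≤ a n) (ha1 : ∀ n, a n ≤ 1) (hg : ∀ k, 0 ≤ g k)
    (hren : IsRenewal a g)
    (i : ℕ) : 0 ≤ survival g i := by
  by_contra! hneg
  have hpos : 0 < -(c * survival g i) := neg_pos.2 (mul_neg_of_pos_of_neg hc hneg)
  obtain ⟨m, hm⟩ := exists_nat_gt (i / -(c * survival g i))
  rw [div_lt_iff₀ hpos] at hm
  have hbound := one_le_add_mul_survival ha ha1 hg hren hc.le hneg.le m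
  push_cast at hbound
  linarith

theorem sum_survival_le (hc : 0 < c) (ha : ∀ n, c ≤ a n) (ha1 : ∀ n, a n ≤ 1) (hg : ∀ k, 0 ≤ g k)
    (hren : IsRenewal a g)
    (n : ℕ) : ∑ i ∈ Finset.range n, survival g i ≤ c⁻¹ := by
  have hnn := survival_nonneg hc ha ha1 hg hren
  calc ∑ i ∈ Finset.range n, survival g i ≤ ∑ i ∈ Finset.range (n + 1), survival g i := by
        rw [Finset.sum_range_succ]
        exact le_add_of_nonneg_right (hnn n)
    _ ≤ c⁻¹ * ∑ i ∈ Finset.range (n + 1), a (n - i) * survival g i := by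
        rw [← div_eq_inv_mul, le_div_iff₀' hc, Finset.mul_sum]
        exact Finset.sum_le_sum fun i _ => mul_le_mul_of_nonneg_right (ha _) (hnn i)
    _ = c⁻¹ := by rw [hren.sum_mul_survival_eq_one, mul_one]

theorem hasSum_of_renewal (hc : 0 < c) (ha : ∀ n, c ≤ a n) (ha1 : ∀ n, a n ≤ 1) (hg : ∀ k, 0 ≤ g k)
    (hren : IsRenewal a g) :
    HasSum g 1 ∧ ∃ m, 1 ≤ m ∧ HasSum (fun k : ℕ => ((k + 1 : ℕ) : ℝ) * g k) m := by
  have hnn := survival_nonneg hc ha ha1 hg hren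
  have hsum := sum_survival_le hc ha ha1 hg hren
  have hone : HasSum g 1 := by
    rw [hasSum_iff_tendsto_nat_of_nonneg hg]
    simpa [survival] using
      (summable_of_sum_range_le hnn hsum).tendsto_atTop_zero.const_sub 1
  have hmean : Summable fun k : ℕ => ((k + 1 : ℕ) : ℝ) * g k := by
    refine summable_of_sum_range_le (c := c⁻¹)
      (fun k => mul_nonneg (Nat.cast_nonneg _) (hg k)) fun n => ?_
    rw [sum_succ_mul_eq_sum_survival]
    exact (sub_le_self _ (mul_nonneg n.cast_nonneg (hnn n))).trans (hsum n)
  refine ⟨hone, _, hasSum_le (fun k => ?_) hone hmean.hasSum, hmean.hasSum⟩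
  exact le_mul_of_one_le_left (hg k) (by exact_mod_cast Nat.le_add_left 1 k)

theorem IsRenewal.mul_le_add (hren : IsRenewal u f) (hu : ∀ n, 0 ≤ u n)
    (hf : ∀ k, 0 ≤ f k) (m n : ℕ) : u m * u n ≤ u (m + n) := by
  induction m using Nat.strong_induction_on with
  | _ m ih =>
    cases m with
    | zero => simp [hren.zero]
    | succ m =>
      calc u (m + 1) * u n = ∑ k ∈ Finset.range (m + 1), f k * (u (m - k) * u n) := by
            simp only [hren.succ m, Finset.sum_mul, mul_assoc]
        _ ≤ ∑ k ∈ Finset.range (m + 1), f k * u (m + n - k) := Finset.sum_le_sum fun k hk => by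
            have hk := Finset.mem_range.1 hk
            rw [Nat.sub_add_comm (by omega)]
            exact mul_le_mul_of_nonneg_left (ih (m - k) (by omega)) (hf k)
        _ ≤ ∑ k ∈ Finset.range (m + n + 1), f k * u (m + n - k) :=
            Finset.sum_le_sum_of_subset_of_nonneg (Finset.range_subset_range.2 (by omega))
              fun k _ _ => mul_nonneg (hf k) (hu _)
        _ = u (m + 1 + n) := by rw [← hren.succ, Nat.add_right_comm]

/-- Fekete's lemma for `-log (u n)` and for `log (C * u n)`, which grow at the same rate. -/
theorem exists_geometric_rate (hpos : ∀ n, 0 < u n) (h1 : ∀ n, u n ≤ 1)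
    (hsup : ∀ m n, u m * u n ≤ u (m + n)) (hsub : ∀ m n, u (m + n) ≤ C * u m * u n) :
    ∃ q : ℝ, 0 < q ∧ q ≤ 1 ∧ (∀ n, u n ≤ q ^ n) ∧ ∀ n, q ^ n ≤ C * u n := by
  have hC0 : 1 ≤ C * u 0 := (le_mul_iff_one_le_left (hpos 0)).1 (hsub 0 0)
  have hC : 0 < C := pos_of_mul_pos_left (one_pos.trans_le hC0) (hpos 0).le
  have hlower : Subadditive fun n => -Real.log (u n) := fun m n => by
    rw [← neg_add, neg_le_neg_iff, ← Real.log_mul (hpos m).ne' (hpos n).ne']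
    exact Real.log_le_log (mul_pos (hpos m) (hpos n)) (hsup m n)
  have hupper : Subadditive fun n => Real.log (C * u n) := fun m n => by
    rw [← Real.log_mul (mul_pos hC (hpos m)).ne' (mul_pos hC (hpos n)).ne']
    refine Real.log_le_log (mul_pos hC (hpos _)) ?_
    calc C * u (m + n) ≤ C * (C * u m * u n) := mul_le_mul_of_nonneg_left (hsub m n) hC.le
      _ = _ := by ring
  have hnn : ∀ n : ℕ, 0 ≤ -Real.log (u n) / n := fun n =>
    div_nonneg (neg_nonneg.2 (Real.log_nonpos (hpos n).le (h1 n))) n.cast_nonneg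
  have hbdd : BddBelow (Set.range fun n : ℕ => -Real.log (u n) / n) :=
    ⟨0, Set.forall_mem_range.2 hnn⟩
  have hlim := hlower.tendsto_lim hbdd
  have hlim' : Tendsto (fun n : ℕ => Real.log (C * u n) / n) atTop (𝓝 (-hlower.lim)) := by
    have hsub := (tendsto_const_div_atTop_nhds_zero_nat (Real.log C)).sub hlim
    rw [zero_sub] at hsub
    refine hsub.congr fun n => ?_
    rw [Real.log_mul hC.ne' (hpos n).ne', ← sub_div, sub_neg_eq_add]
  have hrate : hupper.lim = -hlower.lim :=
    tendsto_nhds_unique (hupper.tendsto_lim hlim'.bddBelow_range) hlim'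
  refine ⟨Real.exp (-hlower.lim), Real.exp_pos _,
    Real.exp_le_one_iff.2 (neg_nonpos.2 (ge_of_tendsto' hlim hnn)), fun n => ?_, fun n => ?_⟩
  · rcases eq_or_ne n 0 with rfl | hn
    · simpa using h1 0
    · have hle := hlower.lim_le_div hbdd hn
      rw [le_div_iff₀ (by positivity)] at hle
      rw [← Real.exp_nat_mul, ← Real.log_le_iff_le_exp (hpos n)]
      linarith
  · rcases eq_or_ne n 0 with rfl | hn
    · simpa using hC0
    · have hle := hupper.lim_le_div hlim'.bddBelow_range hn
      rw [hrate, le_div_iff₀ (by positivity)] at hle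
      rw [← Real.exp_nat_mul, ← Real.le_log_iff_exp_le (mul_pos hC (hpos n))]
      linarith

theorem exists_renewal_rate (hren : IsRenewal u f) (hpos : 0 < u 1) (hu : ∀ n, 0 ≤ u n)
    (h1 : ∀ n, u n ≤ 1) (hf : ∀ k, 0 ≤ f k) (hsub : ∀ m n, u (m + n) ≤ C * u m * u n) :
    ∃ q : ℝ, 0 < q ∧ q ≤ 1 ∧ (∀ n, u n ≤ q ^ n) ∧ (∀ n, q ^ n ≤ C * u n) ∧
      HasSum (fun k : ℕ => f k / q ^ (k + 1)) 1 ∧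
      ∃ m : ℝ, 1 ≤ m ∧ HasSum (fun k : ℕ => ((k + 1 : ℕ) : ℝ) * f k / q ^ (k + 1)) m := by
  have hsup := hren.mul_le_add hu hf
  have hupos : ∀ n, 0 < u n := by
    intro n
    induction n with
    | zero => simp [hren.zero]
    | succ n ih => exact (mul_pos ih hpos).trans_le (hsup n 1)
  obtain ⟨q, hq0, hq1, hqu, hqC⟩ := exists_geometric_rate hupos h1 hsup hsub
  have hC : 0 < C := pos_of_mul_pos_left ((pow_pos hq0 0).trans_le (hqC 0)) (hu 0)
  refine ⟨q, hq0, hq1, hqu, hqC, ?_⟩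
  simp only [mul_div_assoc]
  refine hasSum_of_renewal (a := fun n => u n / q ^ n) (inv_pos.2 hC) (fun n => ?_) (fun n => ?_)
    (fun k => div_nonneg (hf k) (pow_pos hq0 _).le) ⟨by simp [hren.zero], fun n => ?_⟩
  · rw [le_div_iff₀ (pow_pos hq0 n), inv_mul_le_iff₀ hC]
    exact hqC n
  · exact div_le_one_of_le₀ (hqu n) (pow_pos hq0 n).le
  · rw [hren.succ n, Finset.sum_div]
    refine Finset.sum_congr rfl fun k hk => ?_
    have hk := Finset.mem_range.1 hk
    rw [div_mul_div_comm, ← pow_add, show k + 1 + (n - k) = n + 1 by omega]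

theorem summable_div_pow_of_sum_mul_le {b : ℕ → ℝ} {q B : ℝ} (hq : 0 < q) (hC : 0 ≤ C)
    (hB : 0 ≤ B) (hb : ∀ n, 0 ≤ b n) (hqu : ∀ n, u n ≤ q ^ n) (hqC : ∀ n, q ^ n ≤ C * u n)
    (hconv : ∀ n, ∑ m ∈ Finset.range (n + 1), b m * u (n - m) ≤ B * u n) :
    Summable fun n => b n / q ^ n := by
  have hnn : ∀ n, 0 ≤ b n / q ^ n := fun n => div_nonneg (hb n) (pow_pos hq n).le
  refine summable_of_sum_range_le (c := C * B) hnn fun n => ?_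
  calc ∑ m ∈ Finset.range n, b m / q ^ m ≤ ∑ m ∈ Finset.range (n + 1), b m / q ^ m := by
        rw [Finset.sum_range_succ]
        exact le_add_of_nonneg_right (hnn n)
    _ ≤ ∑ m ∈ Finset.range (n + 1), b m * (C * u (n - m)) / q ^ n := by
        refine Finset.sum_le_sum fun m hm => ?_
        have hm : m ≤ n := Nat.lt_succ_iff.1 (Finset.mem_range.1 hm)
        rw [div_le_div_iff₀ (pow_pos hq m) (pow_pos hq n), mul_assoc]
        refine mul_le_mul_of_nonneg_left ?_ (hb m)
        calc q ^ n = q ^ (n - m) * q ^ m := by rw [← pow_add, Nat.sub_add_cancel hm]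
          _ ≤ _ := mul_le_mul_of_nonneg_right (hqC _) (pow_pos hq m).le
    _ = C * (∑ m ∈ Finset.range (n + 1), b m * u (n - m)) / q ^ n := by
        rw [Finset.mul_sum, Finset.sum_div]
        exact Finset.sum_congr rfl fun m _ => by ring
    _ ≤ C * (B * q ^ n) / q ^ n := by
        have := pow_pos hq n
        gcongr
        exact (hconv n).trans (mul_le_mul_of_nonneg_left (hqu n) hB)
    _ = C * B := by
        have := pow_pos hq n
        field_simp

end Renewal

/-! ### Trajectories and their killing -/

section FirstTime

variable {p : ℕ → Prop} {t : ℕ}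

theorem firstTime_eq (ht : p t) (hmin : ∀ j < t, ¬ p j) : firstTime p = t := by
  refine le_antisymm (iInf₂_le t ht) (le_iInf₂ fun j hj => ?_)
  exact_mod_cast not_lt.1 fun h => hmin j h hj

theorem exists_firstTime_eq (h : firstTime p < ⊤) :
    ∃ t : ℕ, firstTime p = t ∧ p t ∧ ∀ j < t, ¬ p j := by
  classical
  have hex : ∃ t, p t := by
    by_contra! hn
    simp [firstTime, hn] at h
  have hmin : ∀ j < Nat.find hex, ¬ p j := fun _ hj => Nat.find_min hex hj
  exact ⟨Nat.find hex, firstTime_eq (Nat.find_spec hex) hmin, Nat.find_spec hex, hmin⟩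

theorem coe_lt_firstTime : (t : ℕ∞) < firstTime p ↔ ∀ j ≤ t, ¬ p j := by
  refine ⟨fun h j hj hp => ?_, fun h => ?_⟩
  · exact h.not_ge ((iInf₂_le j hp).trans (by exact_mod_cast hj))
  · by_contra hn
    obtain ⟨i, hi, hp, -⟩ := exists_firstTime_eq ((not_lt.1 hn).trans_lt (ENat.natCast_lt_top t))
    rw [hi, not_lt, Nat.cast_le] at hn
    exact h i hn hp

end FirstTime

section Steps

variable {d : ℕ} {s x : Lattice d} {ξ : ℕ → Lattice d}

/-- The list of the first `t` increments, through which statements about a trajectory are turned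
into statements about finite paths. -/
def steps (ξ : ℕ → Lattice d) (t : ℕ) : List (Lattice d) := (List.range t).map ξ

@[simp] theorem length_steps (ξ : ℕ → Lattice d) (t : ℕ) : (steps ξ t).length = t := by
  simp [steps]

theorem steps_succ (ξ : ℕ → Lattice d) (t : ℕ) : steps ξ (t + 1) = steps ξ t ++ [ξ t] := by
  simp [steps, List.range_succ]

theorem steps_add (ξ : ℕ → Lattice d) (a b : ℕ) :
    steps ξ (a + b) = steps ξ a ++ steps (fun j => ξ (a + j)) b := by
  simp [steps, List.range_add, Function.comp_def]

theorem walk_succ (s : Lattice d) (ξ : ℕ → Lattice d) (t : ℕ) :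
    walk s ξ (t + 1) = walk s ξ t + ξ t := by
  rw [walk, walk, Finset.sum_range_succ, add_assoc]

theorem walk_eq_add_sum_steps (s : Lattice d) (ξ : ℕ → Lattice d) (t : ℕ) :
    walk s ξ t = s + (steps ξ t).sum := by
  induction t with
  | zero => simp [walk, steps]
  | succ t ih => rw [walk_succ, ih, steps_succ, List.sum_append, List.sum_singleton, add_assoc]

theorem walk_add (s : Lattice d) (ξ : ℕ → Lattice d) (a b : ℕ) :
    walk s ξ (a + b) = walk (s + (steps ξ a).sum) (fun j => ξ (a + j)) b := by
  rw [walk_eq_add_sum_steps, walk_eq_add_sum_steps, steps_add, List.sum_append, add_assoc]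

theorem sites_steps (s : Lattice d) (ξ : ℕ → Lattice d) (t : ℕ) :
    sites s (steps ξ t) = (List.range t).map (walk s ξ) := by
  induction t with
  | zero => simp [steps]
  | succ t ih =>
    rw [steps_succ, sites_append, ih, ← walk_eq_add_sum_steps, List.range_succ, List.map_append]
    rfl

theorem mem_sites_steps {t : ℕ} : x ∈ sites s (steps ξ t) ↔ ∃ j < t, walk s ξ j = x := by
  simp [sites_steps]

theorem count_sites_steps (s x : Lattice d) (ξ : ℕ → Lattice d) (t : ℕ) :
    (sites s (steps ξ t)).count x = ((Finset.range t).filter fun j => walk s ξ j = x).card := by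
  induction t with
  | zero => simp [steps]
  | succ t ih =>
    rw [sites_steps, List.range_succ, List.map_append, List.count_append, ← sites_steps, ih,
      Finset.range_add_one, Finset.filter_insert]
    by_cases h : walk s ξ t = x <;> simp [h]

variable [NeZero d]

theorem walk_succ_zero_le (hξ : ∀ j, ξ j 0 ≤ 1) (s : Lattice d) (t : ℕ) :
    walk s ξ (t + 1) 0 ≤ walk s ξ t 0 + 1 := by
  rw [walk_succ, Pi.add_apply]
  linarith [hξ t]

theorem firstPassage_steps {n : ℤ} {t : ℕ} :
    FirstPassage s n (steps ξ t) ↔ walk s ξ t 0 = n ∧ ∀ j < t, walk s ξ j 0 < n := by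
  rw [FirstPassage, ← walk_eq_add_sum_steps]
  simp only [mem_sites_steps, forall_exists_index, and_imp, forall_apply_eq_imp_iff₂]

theorem separates_steps {m : ℤ} {t : ℕ} :
    Separates s (steps ξ t) m ↔ ∃ i ≤ t, walk s ξ i 0 = m ∧ (∀ j < i, walk s ξ j 0 < m) ∧
      ∀ j, i ≤ j → j < t → m ≤ walk s ξ j 0 := by
  constructor
  · rintro ⟨l₁, l₂, e, h1, h2⟩
    have hlen : t = l₁.length + l₂.length := by
      rw [← List.length_append, ← e, length_steps]
    rw [hlen, steps_add] at e
    obtain ⟨e1, e2⟩ := List.append_inj e.symm (by simp)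
    generalize l₁.length = i at e1 e2 hlen
    generalize l₂.length = b at e2 hlen
    subst e1 e2 hlen
    obtain ⟨hw, hlt⟩ := firstPassage_steps.1 h1
    refine ⟨i, Nat.le_add_right i b, hw, hlt, fun j hij hjt => ?_⟩
    obtain ⟨c, rfl⟩ := Nat.exists_eq_add_of_le hij
    exact h2 _ (mem_sites_steps.2 ⟨c, by omega, (walk_add s ξ i c).symm⟩)
  · rintro ⟨i, hit, h1, h2, h3⟩
    obtain ⟨b, rfl⟩ := Nat.exists_eq_add_of_le hit
    refine ⟨_, _, steps_add ξ i b, firstPassage_steps.2 ⟨h1, h2⟩, fun x hx => ?_⟩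
    obtain ⟨j, hj, rfl⟩ := mem_sites_steps.1 hx
    rw [← walk_add]
    exact h3 _ (by omega) (by omega)

end Steps

section Trajectory

variable {d : ℕ} {y : ℕ → Lattice d} {n t : ℕ} {h : Lattice d → ℕ∞}

theorem card_filter_eq_le_of_localTime_le (hr : ∀ j ≤ t, (localTime y j (y j) : ℕ∞) ≤ h (y j))
    (x : Lattice d) : (((Finset.range t).filter fun j => y j = x).card : ℕ∞) ≤ h x := by
  set V := (Finset.range t).filter fun j => y j = x
  rcases V.eq_empty_or_nonempty with hV | hV
  · simp [hV]
  obtain ⟨hlast, hx⟩ := Finset.mem_filter.1 (V.max'_mem hV)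
  refine le_trans ?_ ((hr _ (Finset.mem_range.1 hlast).le).trans_eq (congrArg h hx))
  unfold localTime
  norm_cast
  refine Finset.card_le_card fun i hi => Finset.mem_filter.2 ⟨?_, ?_⟩
  · exact Finset.mem_range.2 (Nat.lt_succ_of_le (V.le_max' i hi))
  · exact (Finset.mem_filter.1 hi).2.trans hx.symm

variable [NeZero d]

theorem hit_eq (ht : y t 0 = n) (hlt : ∀ j < t, y j 0 < n) : hit n y = t :=
  firstTime_eq ht.ge fun j hj => not_le.2 (hlt j hj)

theorem exists_hit_eq (h0 : y 0 0 ≤ n) (hsf : ∀ t, y (t + 1) 0 ≤ y t 0 + 1) (h : hit n y < ⊤) :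
    ∃ t : ℕ, hit n y = t ∧ y t 0 = n ∧ ∀ j < t, y j 0 < n := by
  obtain ⟨t, ht, hp, hmin⟩ := exists_firstTime_eq h
  refine ⟨t, ht, le_antisymm ?_ hp, fun j hj => not_le.1 (hmin j hj)⟩
  cases t with
  | zero => exact h0
  | succ t =>
    have hlt := hmin t t.lt_succ_self
    have hle := hsf t
    omega

theorem isSeparating_iff (ht : y t 0 = n) (hlt : ∀ j < t, y j 0 < n) {k : ℕ} :
    IsSeparating n y k ↔ k ≤ n ∧ ∃ i ≤ t, y i 0 = k ∧ (∀ j < i, y j 0 < k) ∧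
      ∀ j, i ≤ j → j < t → (k : ℤ) ≤ y j 0 := by
  unfold IsSeparating
  rw [hit_eq ht hlt]
  refine and_congr_right fun hk => ⟨?_, ?_⟩
  · rintro ⟨-, h1, h2, h3⟩
    have hle : hit k y ≤ t := iInf₂_le t (by rw [ht]; exact_mod_cast hk)
    obtain ⟨i, hi, -, -⟩ := exists_firstTime_eq (hle.trans_lt (ENat.natCast_lt_top t))
    replace hi : hit k y = i := hi
    rw [hi] at h1 h2 h3 hle
    rw [ENat.toNat_natCast] at h2
    simp only [Nat.cast_lt, Nat.cast_le] at h1 h3 hle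
    refine ⟨i, hle, h2, h1, fun j hij hjt => ?_⟩
    rcases hij.eq_or_lt with rfl | hij
    · exact h2.ge
    · exact h3 j hij hjt
  · rintro ⟨i, -, h1, h2, h3⟩
    rw [hit_eq h1 h2, ENat.toNat_natCast]
    simp only [Nat.cast_lt]
    exact ⟨ENat.natCast_lt_top t, h2, h1, fun j hij hjt => h3 j hij.le hjt⟩

theorem reaches_iff_forall_localTime_le (hn : hit n y = t) (h : Lattice d → ℕ∞) :
    Reaches n y h ↔ ∀ j ≤ t, (localTime y j (y j) : ℕ∞) ≤ h (y j) := by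
  unfold Reaches killTime
  rw [hn, coe_lt_firstTime]
  simp only [not_lt]

theorem localTime_eq_one (ht : y t 0 = n) (hlt : ∀ j < t, y j 0 < n) :
    localTime y t (y t) = 1 := by
  rw [localTime, Finset.card_eq_one]
  refine ⟨t, Finset.ext fun i => ?_⟩
  simp only [Finset.mem_filter, Finset.mem_range, Finset.mem_singleton]
  refine ⟨fun ⟨_, he⟩ => ?_, by rintro rfl; simp⟩
  by_contra hne
  have := hlt i (by omega)
  rw [he, ht] at this
  exact this.false

theorem reaches_iff_card_filter_eq_le (ht : y t 0 = n) (hlt : ∀ j < t, y j 0 < n)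
    (h1 : 1 ≤ h (y t)) :
    Reaches n y h ↔ ∀ x, (((Finset.range t).filter fun j => y j = x).card : ℕ∞) ≤ h x := by
  rw [reaches_iff_forall_localTime_le (hit_eq ht hlt)]
  refine ⟨card_filter_eq_le_of_localTime_le, fun hc j hj => ?_⟩
  rcases hj.eq_or_lt with rfl | hj
  · rw [localTime_eq_one ht hlt]
    exact_mod_cast h1
  · refine le_trans ?_ (hc (y j))
    unfold localTime
    norm_cast
    exact Finset.card_le_card
      (Finset.filter_subset_filter _ (Finset.range_subset_range.2 hj))

theorem etaStar_eq_eta (hr : Reaches n y h) : etaStar n y h = eta n y := if_pos hr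

theorem reaches_of_etaStar_ne (hη : etaStar n y h ≠ -1) : Reaches n y h := by
  by_contra hn
  exact hη (if_neg hn)

theorem kappa_eq_zero_iff (hn : 0 < n) (h0 : IsSeparating n y 0) :
    kappa n y = (0 : ℕ) ↔ ∀ j, 0 < j → j < n → ¬ IsSeparating n y j := by
  classical
  unfold kappa
  constructor
  · intro hk j hj0 hjn hj
    have := Finset.le_max_of_eq (Finset.mem_filter.2 ⟨Finset.mem_range.2 hjn, hj⟩) hk
    omega
  · intro hns
    have hset : (Finset.range n).filter (IsSeparating n y) = {0} := by
      ext j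
      rw [Finset.mem_filter, Finset.mem_range, Finset.mem_singleton]
      refine ⟨fun ⟨hj, hs⟩ => ?_, by rintro rfl; exact ⟨hn, h0⟩⟩
      by_contra hj0
      exact hns j (Nat.pos_of_ne_zero hj0) hj hs
    rw [hset]
    rfl

theorem one_le_etaStar (hn : 0 < n) (hr : Reaches n y h) (h0 : IsSeparating n y 0)
    (hsep : IsSeparating n y n) : 1 ≤ etaStar n y h := by
  classical
  rw [etaStar_eq_eta hr, eta]
  have hsub : ({0, n} : Finset ℕ) ⊆ (Finset.range (n + 1)).filter (IsSeparating n y) := by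
    simp [Finset.insert_subset_iff, h0, hsep]
  have hcard := Finset.card_le_card hsub
  rw [Finset.card_pair hn.ne] at hcard
  omega

theorem reaches_and_kappa_eq_of_kappaStar_eq {k : ℕ} (hk : kappaStar n y h = k) :
    Reaches n y h ∧ kappa n y = k := by
  by_cases hη : 1 ≤ etaStar n y h
  · rw [kappaStar, if_pos hη] at hk
    exact ⟨reaches_of_etaStar_ne (by omega), hk⟩
  · rw [kappaStar, if_neg hη] at hk
    exact absurd hk WithBot.bot_ne_coe

end Trajectory

section Allows

variable {d : ℕ} {h : Lattice d → ℕ∞} {M : List (Lattice d)}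

/-- The environment `h` allows the visits listed, with multiplicity, in `M`. -/
def Allows (h : Lattice d → ℕ∞) (M : List (Lattice d)) : Prop :=
  ∀ x, (M.count x : ℕ∞) ≤ h x

variable [NeZero d]

theorem allows_zeroBelow_iff :
    Allows (zeroBelow h) M ↔ (∀ x ∈ M, 0 ≤ x 0) ∧ Allows h M := by
  refine ⟨fun ha => ⟨fun x hx => ?_, fun x => (ha x).trans ?_⟩, fun ⟨hpos, ha⟩ x => ?_⟩
  · by_contra hneg
    have hzero := ha x
    rw [zeroBelow, if_neg hneg, nonpos_iff_eq_zero, Nat.cast_eq_zero] at hzero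
    exact List.count_eq_zero.1 hzero hx
  · unfold zeroBelow
    split_ifs <;> simp
  · unfold zeroBelow
    split_ifs with hx
    · exact ha x
    · simp [List.count_eq_zero_of_not_mem fun hM => hx (hpos x hM)]

end Allows

section WalkEvents

variable {d : ℕ} [NeZero d] {ξ : ℕ → Lattice d} {h : Lattice d → ℕ∞} {s : Lattice d} {n t : ℕ}

theorem isSeparating_walk_iff (hf : FirstPassage s n (steps ξ t)) {k : ℕ} :
    IsSeparating n (walk s ξ) k ↔ k ≤ n ∧ Separates s (steps ξ t) k := by
  obtain ⟨ht, hlt⟩ := firstPassage_steps.1 hf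
  rw [isSeparating_iff ht hlt, separates_steps]

theorem FirstPassage.isSeparating_walk (hf : FirstPassage s n (steps ξ t)) :
    IsSeparating n (walk s ξ) n :=
  (isSeparating_walk_iff hf).2 ⟨le_rfl, hf.separates⟩

theorem reaches_walk_iff (hf : FirstPassage s n (steps ξ t)) (h1 : 1 ≤ h (walk s ξ t)) :
    Reaches n (walk s ξ) h ↔ Allows h (sites s (steps ξ t)) := by
  obtain ⟨ht, hlt⟩ := firstPassage_steps.1 hf
  simp only [reaches_iff_card_filter_eq_le ht hlt h1, Allows, count_sites_steps]

theorem exists_firstPassage_of_reaches (hξ : ∀ j, ξ j 0 ≤ 1) (hs : s 0 ≤ n)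
    (hr : Reaches n (walk s ξ) h) :
    ∃ t, FirstPassage s n (steps ξ t) ∧ Allows h (sites s (steps ξ t)) := by
  obtain ⟨t, ht, hn, hlt⟩ := exists_hit_eq (y := walk s ξ) (by simpa [walk] using hs)
    (walk_succ_zero_le hξ s) (hr.trans_le le_top)
  refine ⟨t, firstPassage_steps.2 ⟨hn, hlt⟩, ?_⟩
  simp only [Allows, count_sites_steps]
  exact card_filter_eq_le_of_localTime_le ((reaches_iff_forall_localTime_le ht h).1 hr)

theorem exists_unseparated_of_etaStar_eq_zero (hξ : ∀ j, ξ j 0 ≤ 1) (hs : s 0 ≤ 0)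
    (hη : etaStar n (walk s ξ) h = 0) :
    ∃ t, Unseparated Set.univ s n (steps ξ t) ∧ Allows h (sites s (steps ξ t)) := by
  classical
  have hr : Reaches n (walk s ξ) h := reaches_of_etaStar_ne (by rw [hη]; norm_num)
  obtain ⟨t, hf, ha⟩ := exists_firstPassage_of_reaches hξ (hs.trans n.cast_nonneg) hr
  refine ⟨t, ⟨hf, fun j _ hj hsep => hj.ne ?_⟩, ha⟩
  rw [etaStar_eq_eta hr, eta] at hη
  have hcard : ((Finset.range (n + 1)).filter (IsSeparating n (walk s ξ))).card ≤ 1 := by omega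
  refine Finset.card_le_one.1 hcard j ?_ n ?_ <;> rw [Finset.mem_filter, Finset.mem_range]
  · exact ⟨by omega, (isSeparating_walk_iff hf).2 ⟨hj.le, hsep⟩⟩
  · exact ⟨n.lt_succ_self, hf.isSeparating_walk⟩

theorem etaStar_zero_eq_zero (hξ : ∀ j, ξ j 0 ≤ 1) (hs : s 0 ≤ 0)
    (hr : Reaches 0 (walk s ξ) h) : etaStar 0 (walk s ξ) h = 0 := by
  obtain ⟨t, hf, -⟩ := exists_firstPassage_of_reaches (n := 0) hξ hs hr
  rw [etaStar_eq_eta hr, eta, zero_add, Finset.range_one, Finset.filter_singleton,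
    if_pos hf.isSeparating_walk]
  simp

theorem Upward.isSeparating_walk_zero (hu : Upward n (steps ξ t)) :
    IsSeparating n (walk 0 ξ) 0 := by
  have hpos : ∀ x ∈ sites (0 + List.sum []) (steps ξ t), 0 ≤ x 0 := by simpa using hu.2
  exact (isSeparating_walk_iff hu.1).2
    ⟨n.zero_le, [], steps ξ t, rfl, ⟨by simp, by simp⟩, by simpa using hpos⟩

theorem Upward.kappa_eq_zero_iff (hu : Upward n (steps ξ t)) (hn : 0 < n) :
    kappa n (walk 0 ξ) = (0 : ℕ) ↔ IsBlock n (steps ξ t) := by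
  rw [LocalConstraints.kappa_eq_zero_iff hn hu.isSeparating_walk_zero, IsBlock, and_iff_right hu]
  simp +contextual only [isSeparating_walk_iff hu.1, LT.lt.le, true_and]

theorem kappaStar_eq_zero_iff (hξ : ∀ j, ξ j 0 ≤ 1) (h1 : ∀ x : Lattice d, 0 ≤ x 0 → 1 ≤ h x)
    (hn : 0 < n) :
    kappaStar n (walk 0 ξ) (zeroBelow h) = (0 : ℕ) ↔
      ∃ t, IsBlock n (steps ξ t) ∧ Allows h (sites 0 (steps ξ t)) := by
  constructor
  · intro hk
    obtain ⟨hr, hk⟩ := reaches_and_kappa_eq_of_kappaStar_eq hk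
    obtain ⟨t, hf, ha⟩ := exists_firstPassage_of_reaches hξ (by simp) hr
    obtain ⟨hpos, ha⟩ := allows_zeroBelow_iff.1 ha
    exact ⟨t, (Upward.kappa_eq_zero_iff ⟨hf, hpos⟩ hn).1 hk, ha⟩
  · rintro ⟨t, hb, ha⟩
    have hend : 0 ≤ walk 0 ξ t 0 := by
      rw [(firstPassage_steps.1 hb.1.1).1]
      exact n.cast_nonneg
    have hr : Reaches n (walk 0 ξ) (zeroBelow h) := by
      rw [reaches_walk_iff hb.1.1 (by rw [zeroBelow, if_pos hend]; exact h1 _ hend)]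
      exact allows_zeroBelow_iff.2 ⟨hb.1.2, ha⟩
    rw [kappaStar, if_pos (one_le_etaStar hn hr hb.1.isSeparating_walk_zero
      hb.1.1.isSeparating_walk)]
    exact (hb.1.kappa_eq_zero_iff hn).2 hb

end WalkEvents

/-! ### Probabilities of families of paths -/

section PathEvents

variable {d : ℕ} {Ω : Type*} {ξ : ℕ → Ω → Lattice d} {H : Lattice d → Ω → ℕ∞}
  {l l' M : List (Lattice d)}

/-- The event that the walk starts with the steps `l`. -/
def startsWith (ξ : ℕ → Ω → Lattice d) (l : List (Lattice d)) : Set Ω :=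
  {ω | steps (fun j => ξ j ω) l.length = l}

/-- The event that the constraints allow the visits `M`. -/
def allowed (H : Lattice d → Ω → ℕ∞) (M : List (Lattice d)) : Set Ω :=
  {ω | Allows (fun x => H x ω) M}

/-- No list satisfying `F` properly extends another one, so that a trajectory starts with at most
one of them. -/
def PrefixFree {α : Type*} (F : List α → Prop) : Prop :=
  ∀ ⦃l l'⦄, F l → F l' → l <+: l' → l = l'

theorem mem_startsWith_steps (ξ : ℕ → Ω → Lattice d) (t : ℕ) (ω : Ω) :
    ω ∈ startsWith ξ (steps (fun j => ξ j ω) t) := by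
  simp [startsWith]

theorem startsWith_eq_biInter (l : List (Lattice d)) :
    startsWith ξ l = ⋂ i ∈ Finset.range l.length, ξ i ⁻¹' {l.getD i 0} := by
  ext ω
  simp only [startsWith, Set.mem_ofPred_eq, Set.mem_iInter, Finset.mem_range, Set.mem_preimage,
    Set.mem_singleton_iff]
  refine ⟨fun h i hi => ?_, fun h => List.ext_getElem (by simp) fun i h1 h2 => ?_⟩
  · simpa [steps, hi] using congrArg (fun l' => l'.getD i 0) h
  · simpa [steps, h2] using h i h2

theorem allowed_eq_biInter (M : List (Lattice d)) :
    allowed H M = ⋂ x ∈ M.toFinset, H x ⁻¹' Set.Ici (M.count x : ℕ∞) := by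
  ext ω
  simp only [allowed, Allows, Set.mem_ofPred_eq, Set.mem_iInter, Set.mem_preimage, Set.mem_Ici,
    List.mem_toFinset]
  refine ⟨fun h x _ => h x, fun h x => ?_⟩
  by_cases hx : x ∈ M
  · exact h x hx
  · simp [List.count_eq_zero_of_not_mem hx]

theorem prod_range_getD (p : Lattice d → ℝ≥0∞) (l : List (Lattice d)) :
    ∏ i ∈ Finset.range l.length, p (l.getD i 0) = pathProb p l := by
  induction l with
  | nil => simp
  | cons a l ih =>
    rw [List.length_cons, Finset.prod_range_succ', pathProb_cons, ← ih, mul_comm]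
    simp

theorem setOf_exists_steps (F : List (Lattice d) → Prop) (C : List (Lattice d) → Set Ω) :
    {ω | ∃ t, F (steps (fun j => ξ j ω) t) ∧ ω ∈ C (steps (fun j => ξ j ω) t)} =
      ⋃ l : {l // F l}, startsWith ξ l ∩ C l := by
  ext ω
  simp only [Set.mem_ofPred_eq, Set.mem_iUnion, Subtype.exists, Set.mem_inter_iff]
  constructor
  · rintro ⟨t, hF, hC⟩
    exact ⟨_, hF, mem_startsWith_steps ξ t ω, hC⟩
  · rintro ⟨l, hF, hl, hC⟩
    replace hl : steps (fun j => ξ j ω) l.length = l := hl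
    exact ⟨l.length, hl.symm ▸ hF, hl.symm ▸ hC⟩

theorem isPrefix_of_mem_startsWith {ω : Ω} (h : ω ∈ startsWith ξ l) (h' : ω ∈ startsWith ξ l')
    (hle : l.length ≤ l'.length) : l <+: l' := by
  obtain ⟨b, hb⟩ := Nat.exists_eq_add_of_le hle
  replace h : steps (fun j => ξ j ω) l.length = l := h
  replace h' : steps (fun j => ξ j ω) l'.length = l' := h'
  rw [hb, steps_add, h] at h'
  exact ⟨_, h'⟩

theorem PrefixFree.pairwise_disjoint_startsWith {F : List (Lattice d) → Prop}
    (hF : PrefixFree F) :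
    Pairwise (Function.onFun Disjoint fun l : {l // F l} => startsWith ξ l.1) := by
  rintro ⟨l, hl⟩ ⟨l', hl'⟩ hne
  refine Set.disjoint_left.2 fun ω hω hω' => hne (Subtype.ext ?_)
  rcases le_total l.length l'.length with hle | hle
  · exact hF hl hl' (isPrefix_of_mem_startsWith hω hω' hle)
  · exact (hF hl' hl (isPrefix_of_mem_startsWith hω' hω hle)).symm

section Measurability

variable [MeasurableSpace Ω]

theorem measurableSet_startsWith (hξ : ∀ j, Measurable (ξ j)) (l : List (Lattice d)) :
    MeasurableSet (startsWith ξ l) := by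
  rw [startsWith_eq_biInter]
  exact Finset.measurableSet_biInter _ fun i _ => hξ i (.singleton _)

theorem measurableSet_allowed (hH : ∀ x ∈ M, Measurable (H x)) : MeasurableSet (allowed H M) := by
  rw [allowed_eq_biInter]
  exact Finset.measurableSet_biInter _ fun x hx => hH x (List.mem_toFinset.1 hx) .of_discrete

end Measurability

section Measure

variable [MeasurableSpace Ω] {P : Measure Ω}

open Classical in
theorem measure_exists_steps_le (F : List (Lattice d) → Prop) (C : List (Lattice d) → Set Ω) :
    P {ω | ∃ t, F (steps (fun j => ξ j ω) t) ∧ ω ∈ C (steps (fun j => ξ j ω) t)} ≤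
      ∑' l, if F l then P (startsWith ξ l ∩ C l) else 0 := by
  rw [setOf_exists_steps]
  refine (measure_iUnion_le _).trans_eq ?_
  exact (tsum_subtype {l | F l} fun l => P (startsWith ξ l ∩ C l)).trans
    (tsum_congr fun l => by simp [Set.indicator_apply])

open Classical in
theorem measure_exists_steps {F : List (Lattice d) → Prop} {C : List (Lattice d) → Set Ω}
    (hF : PrefixFree F) (hξ : ∀ j, Measurable (ξ j)) (hC : ∀ l, MeasurableSet (C l)) :
    P {ω | ∃ t, F (steps (fun j => ξ j ω) t) ∧ ω ∈ C (steps (fun j => ξ j ω) t)} =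
      ∑' l, if F l then P (startsWith ξ l ∩ C l) else 0 := by
  rw [setOf_exists_steps, measure_iUnion
    (fun l l' hne => (hF.pairwise_disjoint_startsWith hne).mono Set.inter_subset_left
      Set.inter_subset_left)
    fun l => (measurableSet_startsWith hξ l).inter (hC l)]
  exact (tsum_subtype {l | F l} fun l => P (startsWith ξ l ∩ C l)).trans
    (tsum_congr fun l => by simp [Set.indicator_apply])

end Measure

end PathEvents

section Laws

variable {d : ℕ} {Ω : Type*} [MeasurableSpace Ω] {P : Measure Ω} {ξ : ℕ → Ω → Lattice d}
  {H : Lattice d → Ω → ℕ∞} {S₀ : Ω → Lattice d}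

/-- The distribution of a step. -/
def stepLaw (P : Measure Ω) (ξ : ℕ → Ω → Lattice d) (a : Lattice d) : ℝ≥0∞ := P {ω | ξ 0 ω = a}

/-- The tail function `k ↦ P(H(0) ≥ k)` of the constraints. -/
def tailProb (P : Measure Ω) (H : Lattice d → Ω → ℕ∞) (k : ℕ) : ℝ≥0∞ := P {ω | (k : ℕ∞) ≤ H 0 ω}

theorem tailProb_antitone : Antitone (tailProb P H) := fun _ _ hab =>
  measure_mono fun ω (hω : _ ≤ H 0 ω) => (Nat.cast_le.2 hab).trans hω

section Tail

variable [IsProbabilityMeasure P]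

theorem tailProb_zero : tailProb P H 0 = 1 := by simp [tailProb]

theorem exists_tailProb_lt_one (hH : Measurable (H 0)) (h : 0 < P {ω | H 0 ω < ⊤}) :
    ∃ k, tailProb P H (k + 1) < 1 := by
  by_contra! hn
  refine h.ne' (measure_mono_null (t := ⋃ k : ℕ, {ω | ((k + 1 : ℕ) : ℕ∞) ≤ H 0 ω}ᶜ) ?_ ?_)
  · intro ω (hω : H 0 ω < ⊤)
    obtain ⟨k, hk⟩ := ENat.ne_top_iff_exists.1 hω.ne
    refine Set.mem_iUnion.2 ⟨k, ?_⟩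
    rw [Set.mem_compl_iff, Set.mem_ofPred_eq, ← hk, not_le, Nat.cast_lt]
    exact k.lt_succ_self
  · refine measure_iUnion_null_iff.2 fun k => ?_
    have hm : MeasurableSet {ω | ((k + 1 : ℕ) : ℕ∞) ≤ H 0 ω} := hH (.of_discrete (s := Set.Ici _))
    exact (prob_compl_eq_zero_iff hm).2 (le_antisymm prob_le_one (hn k))

theorem tsum_ite_natCast_le (N : ℕ∞) :
    ∑' k : ℕ, (if (k : ℕ∞) ≤ N then 1 else 0 : ℝ≥0∞) ≤ (N : ℝ≥0∞) + 1 := by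
  induction N using ENat.recTopCoe with
  | top => simp
  | coe N =>
    rw [tsum_eq_sum (s := Finset.range (N + 1)) fun k hk => if_neg (by simpa using hk)]
    refine (Finset.sum_le_card_nsmul _ _ 1 fun k _ => ?_).trans (by simp)
    split_ifs <;> simp

theorem tsum_tailProb_ne_top (hH : Measurable (H 0)) (h : ∫⁻ ω, (H 0 ω : ℝ≥0∞) ∂P < ⊤) :
    ∑' k, tailProb P H k ≠ ⊤ := by
  have hm : ∀ k : ℕ, MeasurableSet {ω | (k : ℕ∞) ≤ H 0 ω} := fun k =>
    hH (.of_discrete (s := Set.Ici (k : ℕ∞)))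
  refine ne_top_of_le_ne_top (b := ∫⁻ ω, ((H 0 ω : ℝ≥0∞) + 1) ∂P) ?_ ?_
  · rw [lintegral_add_right _ measurable_const]
    simpa using h.ne
  calc ∑' k, tailProb P H k
      = ∑' k : ℕ, ∫⁻ ω, {ω | (k : ℕ∞) ≤ H 0 ω}.indicator 1 ω ∂P :=
        tsum_congr fun k => (lintegral_indicator_one (hm k)).symm
    _ = ∫⁻ ω, ∑' k : ℕ, ({ω | (k : ℕ∞) ≤ H 0 ω}.indicator 1 ω : ℝ≥0∞) ∂P :=
        (lintegral_tsum fun k => (measurable_one.indicator (hm k)).aemeasurable).symm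
    _ ≤ ∫⁻ ω, ((H 0 ω : ℝ≥0∞) + 1) ∂P := lintegral_mono fun ω => by
        simpa [Set.indicator_apply] using tsum_ite_natCast_le (H 0 ω)

end Tail

variable [NeZero d]

theorem A1.measure_startsWith (h1 : A1 P ξ) (l : List (Lattice d)) :
    P (startsWith ξ l) = pathProb (stepLaw P ξ) l := by
  rw [startsWith_eq_biInter, h1.indep.measure_inter_preimage_eq_mul _ fun i _ => .singleton _,
    ← prod_range_getD]
  exact Finset.prod_congr rfl fun i _ => (h1.ident i).measure_mem_eq (.singleton _)

theorem A1.ae_skipFree (h1 : A1 P ξ) : ∀ᵐ ω ∂P, ∀ j, ξ j ω 0 ≤ 1 :=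
  ae_all_iff.2 fun j => (h1.ident j).symm.ae_snd (p := fun a : Lattice d => a 0 ≤ 1)
    .of_discrete h1.skipFree

theorem A1.skipFree_stepLaw (h1 : A1 P ξ) (a : Lattice d) (ha : stepLaw P ξ a ≠ 0) : a 0 ≤ 1 := by
  by_contra hlt
  refine ha (measure_mono_null (fun ω hω => ?_) (ae_iff.1 h1.skipFree))
  have hω : ξ 0 ω = a := hω
  simpa only [Set.mem_ofPred_eq, hω] using hlt

theorem A1.exists_stepLaw_ne_zero (h1 : A1 P ξ) :
    ∃ a : Lattice d, a 0 = 1 ∧ stepLaw P ξ a ≠ 0 := by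
  by_contra! hn
  refine h1.up.ne' (measure_mono_null (t := ⋃ a : {a : Lattice d // a 0 = 1}, {ω | ξ 0 ω = a})
    (fun ω hω => Set.mem_iUnion.2 ⟨⟨ξ 0 ω, hω⟩, rfl⟩) ?_)
  exact measure_iUnion_null_iff.2 fun a => hn a a.2

theorem A3.tailProb_one [IsProbabilityMeasure P] (h3 : A3 P H) : tailProb P H 1 = 1 := by
  have hone : ∀ᵐ ω ∂P, ((1 : ℕ) : ℕ∞) ≤ H 0 ω := by simpa using h3.one_le
  rw [tailProb, measure_congr (Filter.eventuallyEq_univ.2 hone), measure_univ]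

theorem A3.ae_one_le (h3 : A3 P H) : ∀ᵐ ω ∂P, ∀ x : Lattice d, 0 ≤ x 0 → 1 ≤ H x ω := by
  refine ae_all_iff.2 fun x => ?_
  by_cases hx : 0 ≤ x 0
  · filter_upwards [(h3.ident x hx).symm.ae_snd (p := fun k : ℕ∞ => 1 ≤ k)
      .of_discrete h3.one_le] with ω hω _ using hω
  · exact Filter.Eventually.of_forall fun ω h => absurd h hx

theorem A3.measure_allowed (h3 : A3 P H) {M : List (Lattice d)} (hM : ∀ x ∈ M, 0 ≤ x 0) :
    P (allowed H M) = allowProb (tailProb P H) M := by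
  have hsub : ∀ x ∈ M.toFinset, 0 ≤ x 0 := fun x hx => hM x (List.mem_toFinset.1 hx)
  have hinter : allowed H M = ⋂ x ∈ M.toFinset.subtype (fun x : Lattice d => 0 ≤ x 0),
      H x ⁻¹' Set.Ici (M.count (x : Lattice d) : ℕ∞) := by
    rw [allowed_eq_biInter]
    ext ω
    simp only [Set.mem_iInter, Finset.mem_subtype, Subtype.forall]
    exact ⟨fun h x _ hx => h x hx, fun h x hx => h x (hsub x hx) hx⟩
  rw [hinter, h3.indep.measure_inter_preimage_eq_mul _ fun x _ => .of_discrete,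
    Finset.prod_subtype_of_mem (fun x => P (H x ⁻¹' Set.Ici (M.count x : ℕ∞))) hsub, allowProb]
  exact Finset.prod_congr rfl fun x hx => (h3.ident x (hsub x hx)).measure_mem_eq .of_discrete

theorem A2.measure_inter (h2 : A2 P S₀ ξ H) (T : Set (Lattice d)) (l : List (Lattice d))
    {M : List (Lattice d)} (hM : ∀ x ∈ M, 0 ≤ x 0) :
    P (S₀ ⁻¹' T ∩ (startsWith ξ l ∩ allowed H M)) =
      P (S₀ ⁻¹' T) * (P (startsWith ξ l) * P (allowed H M)) := by
  have hmul := h2.indep.meas_iInter (s := ![S₀ ⁻¹' T, startsWith ξ l, allowed H M]) fun i => by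
    fin_cases i
    · exact le_sup_left (a := MeasurableSpace.comap S₀ inferInstance) _
        ⟨T, .of_discrete, rfl⟩
    · exact @measurableSet_startsWith _ _ _ (_) (fun j => (comap_measurable (ξ j)).mono
        (le_iSup (fun j => MeasurableSpace.comap (ξ j) inferInstance) j) le_rfl) l
    · exact @measurableSet_allowed _ _ _ _ (_) fun x hx => (comap_measurable (H x)).mono
        (le_iSup (fun x : {x : Lattice d // 0 ≤ x 0} =>
          MeasurableSpace.comap (H x) inferInstance) ⟨x, hM x hx⟩) le_rfl
  rw [Fin.prod_univ_three] at hmul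
  have hinter : S₀ ⁻¹' T ∩ (startsWith ξ l ∩ allowed H M) =
      ⋂ i, (![S₀ ⁻¹' T, startsWith ξ l, allowed H M] : Fin 3 → Set Ω) i := by
    ext ω
    simp [Set.mem_iInter, Fin.forall_fin_succ]
  rw [hinter, hmul, mul_assoc]
  rfl

theorem measure_start_inter_startsWith_inter_allowed (h1 : A1 P ξ) (h2 : A2 P S₀ ξ H)
    (h3 : A3 P H) (T : Set (Lattice d)) (s : Lattice d) (l : List (Lattice d)) :
    P (S₀ ⁻¹' T ∩ (startsWith ξ l ∩ allowed H ((sites s l).filter fun x => 0 ≤ x 0))) =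
      P (S₀ ⁻¹' T) * pathWeight (stepLaw P ξ) (tailProb P H) s l := by
  have hM : ∀ x ∈ (sites s l).filter fun x => 0 ≤ x 0, 0 ≤ x 0 :=
    fun x hx => by simpa using List.of_mem_filter hx
  rw [h2.measure_inter T l hM, h1.measure_startsWith, h3.measure_allowed hM, pathWeight]

end Laws

/-! ### Excursions of the walk -/

section Excursions

variable {d : ℕ} [NeZero d]

theorem prefixFree_isExcursion : PrefixFree (IsExcursion (d := d)) := by
  rintro l l' h h' ⟨c, rfl⟩
  by_contra hne
  have hc : c ≠ [] := by rintro rfl; simp at hne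
  obtain ⟨a, l, rfl⟩ := List.exists_cons_of_ne_nil h.1
  refine h'.2.2 (a + l.sum) ?_ (by simpa using h.2.1)
  simpa using add_sum_mem_sites_append (s := a) (l := l) hc

theorem prefixFree_firstVisit (s : Lattice d) : PrefixFree (FirstVisit s) := by
  rintro l l' h h' ⟨c, rfl⟩
  by_contra hne
  have hc : c ≠ [] := by rintro rfl; simp at hne
  exact h'.2 _ (add_sum_mem_sites_append hc) h.1

section Steps

variable {ξ : ℕ → Lattice d} {t : ℕ}

theorem IsExcursion.pos (h : IsExcursion (steps ξ t)) : 0 < t := by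
  simpa using List.length_pos_iff.2 h.1

theorem IsExcursion.walk_ne_zero (h : IsExcursion (steps ξ t)) {j : ℕ} (hj : 0 < j)
    (hjt : j < t) : walk 0 ξ j 0 ≠ 0 := by
  obtain ⟨t, rfl⟩ := Nat.exists_eq_add_one_of_ne_zero h.pos.ne'
  obtain ⟨j, rfl⟩ := Nat.exists_eq_add_one_of_ne_zero hj.ne'
  refine h.2.2 _ ?_
  rw [sites_steps, List.range_succ_eq_map, List.map_cons, List.tail_cons, List.map_map]
  exact List.mem_map.2 ⟨j, List.mem_range.2 (Nat.succ_lt_succ_iff.1 hjt), rfl⟩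

theorem IsExcursion.returnLevel_eq (h : IsExcursion (steps ξ t)) : returnLevel ξ = t := by
  refine firstTime_eq ⟨h.pos, ?_⟩ fun j hjt ⟨hj, hw⟩ => h.walk_ne_zero hj hjt hw
  simpa [walk_eq_add_sum_steps] using h.2.1

theorem IsExcursion.returnOrigin_eq (h : IsExcursion (steps ξ t)) (hs : (steps ξ t).sum = 0) :
    returnOrigin ξ = t := by
  refine firstTime_eq ⟨h.pos, by rw [walk_eq_add_sum_steps, hs, add_zero]⟩
    fun j hjt ⟨hj, hw⟩ => h.walk_ne_zero hj hjt (by rw [hw, Pi.zero_apply])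

end Steps

theorem tsum_excursionLaw (p : Lattice d → ℝ≥0∞) :
    ∑' y, excursionLaw p y =
      ∑' l : List (Lattice d), open Classical in if IsExcursion l then pathProb p l else 0 := by
  simpa only [mul_one] using tsum_excursionLaw_mul (p := p) fun _ => 1

theorem IsExcursion.excursionLaw_sum_ne_zero {p : Lattice d → ℝ≥0∞} {l : List (Lattice d)}
    (h : IsExcursion l) (hp : pathProb p l ≠ 0) : excursionLaw p l.sum ≠ 0 := fun h0 =>
  hp (by simpa [h] using ENNReal.tsum_eq_zero.1 h0 l)

theorem exists_pathProb_excursionLaw_ne_zero {p : Lattice d → ℝ≥0∞} {l : List (Lattice d)}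
    (hl : l.sum 0 = 0) (hne : l ≠ []) (hp : pathProb p l ≠ 0) :
    ∃ L : List (Lattice d), L ≠ [] ∧ L.sum = l.sum ∧ pathProb (excursionLaw p) L ≠ 0 := by
  induction hn : l.length using Nat.strong_induction_on generalizing l with
  | _ n ih =>
    obtain ⟨l₁, l₂, rfl, hexc, -⟩ := exists_excursion_append (s := 0) rfl hl hne
    rw [pathProb_append] at hp
    have hp₁ := hexc.excursionLaw_sum_ne_zero (left_ne_zero_of_mul hp)
    rcases eq_or_ne l₂ [] with rfl | hne₂
    · exact ⟨[l₁.sum], by simp, by simp, by simpa using hp₁⟩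
    have hlen : l₂.length < n := by
      simpa [← hn] using List.length_pos_iff.2 hexc.1
    have hl₂ : l₂.sum 0 = 0 := by
      simpa [hexc.2.1] using hl
    obtain ⟨L, -, hL, hpL⟩ := ih _ hlen hl₂ hne₂ (right_ne_zero_of_mul hp) rfl
    exact ⟨l₁.sum :: L, by simp, by simp [hL], by simpa using ⟨hp₁, hpL⟩⟩

variable {Ω : Type*} [MeasurableSpace Ω] {P : Measure Ω} {ξ : ℕ → Ω → Lattice d}

theorem A1.tsum_pathProb_eq_measure (h1 : A1 P ξ) {F : List (Lattice d) → Prop}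
    [DecidablePred F] (hF : PrefixFree F) :
    ∑' l, (if F l then pathProb (stepLaw P ξ) l else 0) =
      P {ω | ∃ t, F (steps (fun j => ξ j ω) t)} := by
  have hmeas := measure_exists_steps (P := P) (C := fun _ => Set.univ) hF h1.measurable
    fun _ => .univ
  simp only [Set.mem_univ, and_true, Set.inter_univ, h1.measure_startsWith] at hmeas
  rw [hmeas]

theorem A1.exists_pathProb_stepLaw_ne_zero (h1 : A1 P ξ)
    (h : 0 < P {ω | returnOrigin (fun j => ξ j ω) < ⊤}) :
    ∃ l : List (Lattice d), l ≠ [] ∧ l.sum = 0 ∧ pathProb (stepLaw P ξ) l ≠ 0 := by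
  by_contra! hn
  refine h.ne' (measure_mono_null
    (t := ⋃ l : {l : List (Lattice d) // l ≠ [] ∧ l.sum = 0}, startsWith ξ l) ?_ ?_)
  · intro ω hω
    obtain ⟨t, -, ⟨hpos, hwalk⟩, -⟩ := exists_firstTime_eq hω
    refine Set.mem_iUnion.2 ⟨⟨steps (fun j => ξ j ω) t, ?_, ?_⟩, mem_startsWith_steps ξ t ω⟩
    · simpa [← List.length_pos_iff] using hpos
    · rwa [walk_eq_add_sum_steps, zero_add] at hwalk
  · refine measure_iUnion_null_iff.2 fun l => ?_
    rw [h1.measure_startsWith]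
    exact hn l l.2.1 l.2.2

theorem A1.exists_loop (h1 : A1 P ξ) (h : 0 < P {ω | returnOrigin (fun j => ξ j ω) < ⊤}) :
    ∃ L : List (Lattice d), L ≠ [] ∧ L.sum = 0 ∧
      pathProb (excursionLaw (stepLaw P ξ)) L ≠ 0 := by
  obtain ⟨l, hne, hl, hp⟩ := h1.exists_pathProb_stepLaw_ne_zero h
  obtain ⟨L, hL, hLl, hpL⟩ :=
    exists_pathProb_excursionLaw_ne_zero (by rw [hl, Pi.zero_apply]) hne hp
  exact ⟨L, hL, hLl.trans hl, hpL⟩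

variable [IsProbabilityMeasure P]

theorem A1.tsum_pathProb_le_one (h1 : A1 P ξ) {F : List (Lattice d) → Prop} [DecidablePred F]
    (hF : PrefixFree F) : ∑' l, (if F l then pathProb (stepLaw P ξ) l else 0) ≤ 1 :=
  (h1.tsum_pathProb_eq_measure hF).trans_le prob_le_one

theorem A1.tsum_excursionLaw_le_one (h1 : A1 P ξ) : ∑' y, excursionLaw (stepLaw P ξ) y ≤ 1 := by
  classical
  exact (tsum_excursionLaw _).trans_le (h1.tsum_pathProb_le_one prefixFree_isExcursion)

theorem A1.measure_returnLevel_lt_top (h1 : A1 P ξ)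
    (h : ∑' y, excursionLaw (stepLaw P ξ) y = 1) :
    P {ω | returnLevel (fun j => ξ j ω) < ⊤} = 1 := by
  classical
  rw [tsum_excursionLaw, h1.tsum_pathProb_eq_measure prefixFree_isExcursion] at h
  refine le_antisymm prob_le_one (h.ge.trans (measure_mono ?_))
  rintro ω ⟨t, ht⟩
  exact ht.returnLevel_eq.trans_lt (ENat.natCast_lt_top t)

theorem A1.measure_returnLevel_eq_returnOrigin (h1 : A1 P ξ)
    (h : excursionLaw (stepLaw P ξ) 0 = 1) :
    P {ω | returnLevel (fun j => ξ j ω) = returnOrigin (fun j => ξ j ω) ∧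
      returnOrigin (fun j => ξ j ω) < ⊤} = 1 := by
  classical
  have hF : PrefixFree fun l : List (Lattice d) => IsExcursion l ∧ l.sum = 0 :=
    fun l l' hl hl' => prefixFree_isExcursion hl.1 hl'.1
  rw [excursionLaw, h1.tsum_pathProb_eq_measure hF] at h
  refine le_antisymm prob_le_one (h.ge.trans (measure_mono ?_))
  rintro ω ⟨t, ht, hs⟩
  have horigin := ht.returnOrigin_eq hs
  exact ⟨ht.returnLevel_eq.trans horigin.symm, horigin.trans_lt (ENat.natCast_lt_top t)⟩

end Excursions

/-! ### The renewal structure of the model -/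

section Model

variable {d : ℕ} [NeZero d] {Ω : Type*} [MeasurableSpace Ω] {P : Measure Ω}
  {ξ : ℕ → Ω → Lattice d} {H : Lattice d → Ω → ℕ∞} {S₀ : Ω → Lattice d}

theorem measure_etaStar_eq_zero_le (h1 : A1 P ξ) (h2 : A2 P S₀ ξ H) (h3 : A3 P H) (n : ℕ) :
    P {ω | etaStar n (walk (S₀ ω) fun j => ξ j ω) (fun x => H x ω) = 0} ≤
      ∑' s, P (S₀ ⁻¹' {s}) *
        totalWeight (stepLaw P ξ) (tailProb P H) s (Unseparated Set.univ s n) := by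
  classical
  let C (s : Lattice d) (l : List (Lattice d)) : Set Ω :=
    S₀ ⁻¹' {s} ∩ allowed H ((sites s l).filter fun x => 0 ≤ x 0)
  calc P {ω | etaStar n (walk (S₀ ω) fun j => ξ j ω) (fun x => H x ω) = 0}
      ≤ P (⋃ s, {ω | ∃ t, Unseparated Set.univ s n (steps (fun j => ξ j ω) t) ∧
          ω ∈ C s (steps (fun j => ξ j ω) t)}) := by
        refine measure_mono_ae ?_
        filter_upwards [h1.ae_skipFree, h2.start] with ω hω hs hη
        obtain ⟨t, ht, ha⟩ := exists_unseparated_of_etaStar_eq_zero hω hs hη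
        refine Set.mem_iUnion.2 ⟨S₀ ω, t, ht, rfl, fun x => le_trans ?_ (ha x)⟩
        exact_mod_cast List.filter_sublist.count_le x
    _ ≤ ∑' s, P {ω | ∃ t, Unseparated Set.univ s n (steps (fun j => ξ j ω) t) ∧
          ω ∈ C s (steps (fun j => ξ j ω) t)} := measure_iUnion_le _
    _ ≤ ∑' s, ∑' l, if Unseparated Set.univ s n l then P (startsWith ξ l ∩ C s l) else 0 :=
        ENNReal.tsum_le_tsum fun s => measure_exists_steps_le _ (C s)
    _ = ∑' s, P (S₀ ⁻¹' {s}) *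
        totalWeight (stepLaw P ξ) (tailProb P H) s (Unseparated Set.univ s n) := by
        refine tsum_congr fun s => ?_
        rw [totalWeight, ← ENNReal.tsum_mul_left]
        refine tsum_congr fun l => ?_
        rw [Set.inter_left_comm, measure_start_inter_startsWith_inter_allowed h1 h2 h3, mul_ite,
          mul_zero]

variable [IsProbabilityMeasure P]

theorem levelGreen_zero_ne_top (h1 : A1 P ξ) (hH : Measurable (H 0)) (h4 : A4 P ξ H)
    (h5 : P {ω | returnLevel (fun j => ξ j ω) < ⊤} = 1 → 0 < P {ω | H 0 ω < ⊤}) :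
    levelGreen (stepLaw P ξ) (tailProb P H) 0 ≠ ⊤ :=
  ne_top_of_le_ne_top
    (tsum_expect_allowProb_ne_top tailProb_zero tailProb_antitone h1.tsum_excursionLaw_le_one
      (fun h => h1.exists_loop (h4.return_origin (h1.measure_returnLevel_lt_top h)))
      (fun h => exists_tailProb_lt_one hH (h5 (h1.measure_returnLevel_lt_top h)))
      fun h => tsum_tailProb_ne_top hH
        (h4.finite_mean (h1.measure_returnLevel_eq_returnOrigin h)))
    levelGreen_zero_le

theorem levelGreen_le_levelGreen_zero (h1 : A1 P ξ) (s : Lattice d) :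
    levelGreen (stepLaw P ξ) (tailProb P H) s ≤ levelGreen (stepLaw P ξ) (tailProb P H) 0 := by
  classical
  exact (levelGreen_le_mul_levelGreen_zero tailProb_zero tailProb_antitone s).trans
    (mul_le_of_le_one_left' (h1.tsum_pathProb_le_one (prefixFree_firstVisit s)))

theorem totalWeight_firstPassage_le_climbProb (h1 : A1 P ξ) (h3 : A3 P H) {s : Lattice d}
    (hs : s 0 ≤ 0) (n : ℕ) :
    totalWeight (stepLaw P ξ) (tailProb P H) s (FirstPassage s n) ≤
      levelGreen (stepLaw P ξ) (tailProb P H) 0 * climbProb (stepLaw P ξ) (tailProb P H) n :=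
  (totalWeight_firstPassage_le h1.skipFree_stepLaw tailProb_zero h3.tailProb_one
    tailProb_antitone hs n).trans (mul_le_mul_left (levelGreen_le_levelGreen_zero h1 s) _)

theorem climbProb_le_one (h1 : A1 P ξ) (n : ℕ) :
    climbProb (stepLaw P ξ) (tailProb P H) n ≤ 1 := by
  classical
  have hF : PrefixFree (Upward (d := d) n) := fun l l' h h' => h.1.eq_of_prefix h'.1
  refine le_trans (ENNReal.tsum_le_tsum fun l => ?_) (h1.tsum_pathProb_le_one hF)
  split_ifs
  · exact mul_le_of_le_one_right' (allowProb_le_one tailProb_zero tailProb_antitone _)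
  · exact le_rfl

theorem climbProb_ne_top (h1 : A1 P ξ) (n : ℕ) :
    climbProb (stepLaw P ξ) (tailProb P H) n ≠ ⊤ :=
  ne_top_of_le_ne_top ENNReal.one_ne_top (climbProb_le_one h1 n)

theorem blockProb_ne_top (h1 : A1 P ξ) (n : ℕ) :
    blockProb (stepLaw P ξ) (tailProb P H) n ≠ ⊤ :=
  ne_top_of_le_ne_top (climbProb_ne_top h1 n) (totalWeight_mono fun _ h => h.1)

theorem climbProb_one_ne_zero (h1 : A1 P ξ) (h3 : A3 P H) :
    climbProb (stepLaw P ξ) (tailProb P H) 1 ≠ 0 := by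
  intro h0
  obtain ⟨a, ha, hpa⟩ := h1.exists_stepLaw_ne_zero
  have hup : Upward 1 [a] := ⟨⟨by simpa using ha, by simp⟩, by simp⟩
  have hweight := ENNReal.tsum_eq_zero.1 h0 [a]
  rw [if_pos hup, pathWeight, hup.filter_sites le_rfl] at hweight
  simp [allowProb, h3.tailProb_one, hpa] at hweight

theorem probKappaZero_eq_blockProb (h1 : A1 P ξ) (h2 : A2 P S₀ ξ H) (h3 : A3 P H) {n : ℕ}
    (hn : 0 < n) :
    probKappaZero P ξ H n = (blockProb (stepLaw P ξ) (tailProb P H) n).toReal := by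
  classical
  refine congrArg ENNReal.toReal ?_
  calc P {ω | kappaStar n (walk 0 fun j => ξ j ω) (zeroBelow fun x => H x ω) = (0 : ℕ)}
      = P {ω | ∃ t, IsBlock n (steps (fun j => ξ j ω) t) ∧
          ω ∈ allowed H (sites 0 (steps (fun j => ξ j ω) t))} := by
        refine measure_congr ?_
        filter_upwards [h1.ae_skipFree, h3.ae_one_le] with ω hω hone
        exact propext (kappaStar_eq_zero_iff hω hone hn)
    _ = ∑' l, if IsBlock n l then P (startsWith ξ l ∩ allowed H (sites 0 l)) else 0 :=
        measure_exists_steps (fun l l' h h' => h.1.1.eq_of_prefix h'.1.1) h1.measurable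
          fun l => measurableSet_allowed fun x _ => h2.measurable_env x
    _ = blockProb (stepLaw P ξ) (tailProb P H) n := by
        refine tsum_congr fun l => ite_congr rfl (fun hl => ?_) fun _ => rfl
        have hprod := measure_start_inter_startsWith_inter_allowed h1 h2 h3 Set.univ 0 l
        rwa [Set.preimage_univ, Set.univ_inter, measure_univ, one_mul,
          hl.1.filter_sites le_rfl] at hprod

theorem sum_measure_etaStar_eq_zero_mul_climbProb_le (h1 : A1 P ξ) (h2 : A2 P S₀ ξ H)
    (h3 : A3 P H) (n : ℕ) :
    ∑ m ∈ Finset.range (n + 1),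
      P {ω | etaStar m (walk (S₀ ω) fun j => ξ j ω) (fun x => H x ω) = 0} *
        climbProb (stepLaw P ξ) (tailProb P H) (n - m) ≤
      levelGreen (stepLaw P ξ) (tailProb P H) 0 * climbProb (stepLaw P ξ) (tailProb P H) n := by
  set N := levelGreen (stepLaw P ξ) (tailProb P H) 0
  set u := climbProb (stepLaw P ξ) (tailProb P H)
  let w (s : Lattice d) (m : ℕ) : ℝ≥0∞ :=
    totalWeight (stepLaw P ξ) (tailProb P H) s (Unseparated Set.univ s m)
  have hS : ∑' s, P (S₀ ⁻¹' {s}) = 1 := by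
    rw [← tsum_univ, tsum_measure_preimage_singleton Set.countable_univ fun s _ =>
      h2.measurable_start (.singleton s), Set.preimage_univ, measure_univ]
  calc ∑ m ∈ Finset.range (n + 1),
        P {ω | etaStar m (walk (S₀ ω) fun j => ξ j ω) (fun x => H x ω) = 0} * u (n - m)
      ≤ ∑ m ∈ Finset.range (n + 1), (∑' s, P (S₀ ⁻¹' {s}) * w s m) * u (n - m) :=
        Finset.sum_le_sum fun m _ =>
          mul_le_mul_left (measure_etaStar_eq_zero_le h1 h2 h3 m) _
    _ = ∑' s, P (S₀ ⁻¹' {s}) * ∑ m ∈ Finset.range (n + 1), w s m * u (n - m) := by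
        simp only [← ENNReal.tsum_mul_right, mul_assoc, Finset.mul_sum]
        exact (Summable.tsum_finsetSum fun _ _ => ENNReal.summable).symm
    _ ≤ ∑' s, P (S₀ ⁻¹' {s}) * (N * u n) := by
        refine ENNReal.tsum_le_tsum fun s => ?_
        by_cases hs : s 0 ≤ 0
        · exact mul_le_mul_right ((sum_unseparated_mul_climbProb_le n s).trans
            (totalWeight_firstPassage_le_climbProb h1 h3 hs n)) _
        · have hnull : P (S₀ ⁻¹' {s}) = 0 := by
            refine measure_mono_null (fun ω hω => ?_) (ae_iff.1 h2.start)
            rwa [Set.mem_ofPred_eq, show S₀ ω = s from hω]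
          rw [hnull, zero_mul, zero_mul]
    _ = N * u n := by rw [ENNReal.tsum_mul_right, hS, one_mul]

theorem probEtaZero_zero_pos (h1 : A1 P ξ) (h2 : A2 P S₀ ξ H) : 0 < probEtaZero P S₀ ξ H 0 := by
  refine ENNReal.toReal_pos (h2.reach.trans_le (measure_mono_ae ?_)).ne' (measure_ne_top _ _)
  filter_upwards [h1.ae_skipFree, h2.start] with ω hω hs hr
  exact etaStar_zero_eq_zero hω hs hr

/-- The probability under `P_0` of reaching level `n` before dying, which is the renewal sequence
of the model. -/
def reachProb (P : Measure Ω) (ξ : ℕ → Ω → Lattice d) (H : Lattice d → Ω → ℕ∞) (n : ℕ) : ℝ :=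
  (climbProb (stepLaw P ξ) (tailProb P H) n).toReal

theorem reachProb_le_one (h1 : A1 P ξ) (n : ℕ) : reachProb P ξ H n ≤ 1 :=
  ENNReal.toReal_le_of_le_ofReal zero_le_one (by simpa using climbProb_le_one h1 n)

theorem reachProb_one_pos (h1 : A1 P ξ) (h3 : A3 P H) : 0 < reachProb P ξ H 1 :=
  ENNReal.toReal_pos (climbProb_one_ne_zero h1 h3) (climbProb_ne_top h1 1)

theorem isRenewal_reachProb (h1 : A1 P ξ) (h2 : A2 P S₀ ξ H) (h3 : A3 P H) :
    IsRenewal (reachProb P ξ H) fun k => probKappaZero P ξ H (k + 1) where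
  zero := by rw [reachProb, climbProb_zero, ENNReal.toReal_one]
  succ n := by
    rw [reachProb, climbProb_eq_sum_blockProb n.succ_pos, ← Finset.Ico_add_one_right_eq_Icc,
      Finset.sum_Ico_eq_sum_range, ENNReal.toReal_sum fun k _ =>
        ENNReal.mul_ne_top (blockProb_ne_top h1 _) (climbProb_ne_top h1 _)]
    refine Finset.sum_congr rfl fun k _ => ?_
    rw [ENNReal.toReal_mul, probKappaZero_eq_blockProb h1 h2 h3 k.succ_pos, add_comm 1 k,
      Nat.succ_sub_succ, reachProb]

theorem reachProb_add_le (h1 : A1 P ξ) (h3 : A3 P H)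
    (hN : levelGreen (stepLaw P ξ) (tailProb P H) 0 ≠ ⊤) (a b : ℕ) :
    reachProb P ξ H (a + b) ≤
      (levelGreen (stepLaw P ξ) (tailProb P H) 0).toReal * reachProb P ξ H a *
        reachProb P ξ H b := by
  simp only [reachProb, ← ENNReal.toReal_mul]
  refine ENNReal.toReal_mono
    (ENNReal.mul_ne_top (ENNReal.mul_ne_top hN (climbProb_ne_top h1 a)) (climbProb_ne_top h1 b)) ?_
  refine (climbProb_add_le h1.skipFree_stepLaw tailProb_zero tailProb_antitone a b).trans ?_
  rw [mul_comm (levelGreen _ _ _), mul_assoc]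
  exact mul_le_mul_right (totalWeight_firstPassage_le_climbProb h1 h3 le_rfl b) _

theorem sum_probEtaZero_mul_reachProb_le (h1 : A1 P ξ) (h2 : A2 P S₀ ξ H) (h3 : A3 P H)
    (hN : levelGreen (stepLaw P ξ) (tailProb P H) 0 ≠ ⊤) (n : ℕ) :
    ∑ m ∈ Finset.range (n + 1), probEtaZero P S₀ ξ H m * reachProb P ξ H (n - m) ≤
      (levelGreen (stepLaw P ξ) (tailProb P H) 0).toReal * reachProb P ξ H n := by
  simp only [reachProb, probEtaZero, Measure.real, ← ENNReal.toReal_mul]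
  rw [← ENNReal.toReal_sum fun m _ =>
    ENNReal.mul_ne_top (measure_ne_top _ _) (climbProb_ne_top h1 _)]
  exact ENNReal.toReal_mono (ENNReal.mul_ne_top hN (climbProb_ne_top h1 n))
    (sum_measure_etaStar_eq_zero_mul_climbProb_le h1 h2 h3 n)

end Model

end LocalConstraints

end

theorem theorem1 {d : ℕ} [NeZero d] {Ω : Type*} [MeasurableSpace Ω]
    (P : Measure Ω) [IsProbabilityMeasure P]
    (S₀ : Ω → LocalConstraints.Lattice d) (ξ : ℕ → Ω → LocalConstraints.Lattice d)
    (H : LocalConstraints.Lattice d → Ω → ℕ∞)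
    (h1 : LocalConstraints.A1 P ξ) (h2 : LocalConstraints.A2 P S₀ ξ H)
    (h3 : LocalConstraints.A3 P H) (h4 : LocalConstraints.A4 P ξ H)
    (h5 : P {ω | LocalConstraints.returnLevel (fun j => ξ j ω) < ⊤} = 1 →
      0 < P {ω | H 0 ω < ⊤}) :
    ∃ q : ℝ, 0 < q ∧ q ≤ 1 ∧
      HasSum (fun k : ℕ => LocalConstraints.probKappaZero P ξ H (k + 1) / q ^ (k + 1)) 1 ∧
      (∃ m : ℝ, 1 ≤ m ∧
        HasSum (fun k : ℕ =>
          ((k + 1 : ℕ) : ℝ) * LocalConstraints.probKappaZero P ξ H (k + 1) / q ^ (k + 1)) m) ∧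
      (∃ ψ₀ : ℝ, 0 < ψ₀ ∧
        HasSum (fun n : ℕ => LocalConstraints.probEtaZero P S₀ ξ H n / q ^ n) ψ₀) := by
  have hN := LocalConstraints.levelGreen_zero_ne_top h1 (h2.measurable_env 0) h4 h5
  obtain ⟨q, hq0, hq1, hqu, hqC, hsum, hmean⟩ := LocalConstraints.exists_renewal_rate
    (LocalConstraints.isRenewal_reachProb h1 h2 h3) (LocalConstraints.reachProb_one_pos h1 h3)
    (fun _ => ENNReal.toReal_nonneg) (LocalConstraints.reachProb_le_one h1)
    (fun _ => measureReal_nonneg) (LocalConstraints.reachProb_add_le h1 h3 hN)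
  have hψ : Summable fun n => LocalConstraints.probEtaZero P S₀ ξ H n / q ^ n :=
    LocalConstraints.summable_div_pow_of_sum_mul_le hq0 ENNReal.toReal_nonneg
      ENNReal.toReal_nonneg (fun _ => measureReal_nonneg) hqu hqC
      (LocalConstraints.sum_probEtaZero_mul_reachProb_le h1 h2 h3 hN)
  refine ⟨q, hq0, hq1, hsum, hmean, _, ?_, hψ.hasSum⟩
  refine hψ.tsum_pos (fun n => div_nonneg measureReal_nonneg (pow_pos hq0 n).le) 0 ?_
  simpa using LocalConstraints.probEtaZero_zero_pos h1 h2
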